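/- Let $d\ge 0$, let $U:\mathbb{R}^d\to\mathbb{R}$ be continuously differentiable with $\int_{\mathbb{R}^d} e^{-U(x)}\,dx<\infty$, let $\pi(x)\propto e^{-U(x)}$, and let $\lambda_{\mathrm{ref}}>0$. Let $\mathcal{V}=\{0\}\cup\{\pm e_i: i=1,\dots,d\}$, where $(e_i)$ is the canonical basis of $\mathbb{R}^d$, let $\varphi$ be the uniform distribution on $\mathcal{V}$, and let $\pi(dx,dv)=\pi(x)\,dx\,\varphi(dv)$ on $\mathbb{R}^d\times\mathcal{V}$. Put $$\lambda(x,v)=\max(\langle v,\nabla U(x)\rangle,0)+\lambda_{\mathrm{ref}},\qquad \lambda(x)=\sum_{w\in\mathcal{V}}\lambda(x,w).$$ The on-and-off coordinate sampler is the piecewise deterministic process $Z_t=(X_t,V_t)$ on $\mathbb{R}^d\times\mathcal{V}$ defined as follows. Between events, $\dot X_t=V_t$ and $\dot V_t=0$. From a state $(x,v)$, the duration until the next event is the first event time of a Poisson process with intensity $t\mapsto\lambda(x+tv,v)$, that is, it has density $\lambda(x+tv,v)\exp\left(-\int_0^t\lambda(x+sv,v)\,ds\right)$ on $(0,\infty)$.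 At an event at position $x$, the velocity is replaced by a new one, drawn from $\mathcal{V}$ with probabilities proportional to $\lambda(x,-w)$, $w\in\mathcal{V}$. Let $P_t(z,\cdot)$ be the law of $Z_t$ given $Z_0=z$. Then: 1. The process is well defined for all times: for every initial state, almost surely the successive event times $0=T_0<T_1<T_2<\cdots$ are strictly increasing and tend to $\infty$. 2. The sampler is $\pi$-invariant: $\pi$ is a probability measure on $\mathbb{R}^d\times\mathcal{V}$, and for every $t\ge 0$, $P_t$ is a Markov kernel and $\pi P_t=\pi$, i.e. if $Z_0\sim\pi$ then $Z_t\sim\pi$. 3. $\pi$ is infinitesimally invariant: for $$\mathcal{L}f(x,v)=\langle\nabla_x f(x,v),v\rangle+\lambda(x,v)\sum_{w\in\mathcal{V}}\frac{\lambda(x,-w)}{\lambda(x)}f(x,w)-\lambda(x,v)f(x,v)$$ and every $f:\mathbb{R}^d\times\mathcal{V}\to\mathbb{R}$ that is differentiable in $x$ and for which $\langle\nabla_x f(x,v),v\rangle$, $\lambda(x,v)f(x,v)$ and $\lambda(x,-v)f(x,v)$ are $\pi$-integrable, $\mathcal{L}f$ is $\pi$-integrable and $\int\mathcal{L}f\,d\pi=0$.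 -/

import Mathlib

open MeasureTheory ProbabilityTheory Filter

namespace IOCS

noncomputable section

/-- The position space `ℝ^d` with its Euclidean structure. -/
abbrev Pos (d : ℕ) : Type := EuclideanSpace ℝ (Fin d)

open Classical in
/-- The velocity set `{0} ∪ {e_i} ∪ {-e_i}`, with `2 d + 1` elements. -/
def velocities (d : ℕ) : Finset (Pos d) :=
  insert 0
    (Finset.univ.image (fun i : Fin d => EuclideanSpace.single i (1 : ℝ)) ∪
      Finset.univ.image (fun i : Fin d => -EuclideanSpace.single i (1 : ℝ)))

/-- The velocity set as a type. -/
abbrev Vel (d : ℕ) : Type := ↥(velocities d)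

/-- States `(x, v)`. -/
abbrev State (d : ℕ) : Type := Pos d × Vel d

/-- One entry `(T_n, (X_{T_n}, V_{T_n}))` of the skeleton of the process: the time of the `n`-th
event and the state just after it. -/
abbrev Mark (d : ℕ) : Type := ℝ × State d

variable {d : ℕ}

/-- The event rate `λ(x, v) = ⟨v, ∇U(x)⟩₊ + λ_ref`. -/
def rate (U : Pos d → ℝ) (lref : ℝ) (x v : Pos d) : ℝ :=
  max (inner ℝ v (gradient U x)) 0 + lref

/-- `λ(x) = ∑_v λ(x, v)`, the sum being over the velocity set. -/
def totalRate (U : Pos d → ℝ) (lref : ℝ) (x : Pos d) : ℝ :=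
  ∑ v : Vel d, rate U lref x v

/-- The density at `t > 0` of the duration until the first event of the Poisson process with
intensity `t ↦ λ(x + t v, v)`. -/
def holdDensity (U : Pos d → ℝ) (lref : ℝ) (z : State d) (t : ℝ) : ℝ :=
  rate U lref (z.1 + t • (z.2 : Pos d)) z.2 *
    Real.exp (-∫ s in (0 : ℝ)..t, rate U lref (z.1 + s • (z.2 : Pos d)) z.2)

/-- The law of the duration until the next event, given the current state. -/
def holdKernel (U : Pos d → ℝ) (lref : ℝ) : Kernel (State d) ℝ :=
  (Kernel.const (State d) (volume.restrict (Set.Ioi (0 : ℝ)))).withDensity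
    (fun z t => ENNReal.ofReal (holdDensity U lref z t))

/-- The probability of picking the velocity `w` at an event at position `x`: proportional to
`λ(x, -w)`. -/
def velProb (U : Pos d → ℝ) (lref : ℝ) (x : Pos d) (w : Vel d) : ℝ :=
  rate U lref x (-(w : Pos d)) / ∑ w' : Vel d, rate U lref x (-(w' : Pos d))

/-- The law of the new velocity at an event, given the position of the event. -/
def velKernel (U : Pos d → ℝ) (lref : ℝ) : Kernel (Pos d) (Vel d) :=
  (Kernel.const (Pos d) Measure.count).withDensity
    (fun x w => ENNReal.ofReal (velProb U lref x w))

/-- The position after following the flow `ẋ = v`, `v̇ = 0` during a time `t`. -/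
def flowPos (z : State d) (t : ℝ) : Pos d := z.1 + t • (z.2 : Pos d)

/-- The next skeleton entry, from the current one, the duration `τ` until the next event and the
velocity `w` picked there. -/
def nextMark (p : Mark d × (ℝ × Vel d)) : Mark d :=
  (p.1.1 + p.2.1, (flowPos p.1.2 p.2.1, p.2.2))

/-- The law of the duration until the next event together with the velocity picked there. -/
def eventKernel (U : Pos d → ℝ) (lref : ℝ) : Kernel (State d) (ℝ × Vel d) :=
  holdKernel U lref ⊗ₖ
    Kernel.comap (velKernel U lref) (fun p : State d × ℝ => flowPos p.1 p.2)
      (by unfold flowPos; fun_prop)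

/-- The transition kernel of the skeleton chain. -/
def stepKernel (U : Pos d → ℝ) (lref : ℝ) : Kernel (Mark d) (Mark d) :=
  (Kernel.id ×ₖ Kernel.comap (eventKernel U lref) Prod.snd measurable_snd).map nextMark

lemma measurable_nextMark : Measurable (nextMark (d := d)) := by
  unfold nextMark flowPos
  fun_prop

lemma continuous_rate {U : Pos d → ℝ} (hU : ContDiff ℝ 1 U) (lref : ℝ) :
    Continuous (fun p : Pos d × Pos d => rate U lref p.1 p.2) := by
  have h : Continuous (gradient U) := by
    have h1 : Continuous (fderiv ℝ U) := hU.continuous_fderiv (by norm_num)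
    exact (LinearIsometryEquiv.continuous _).comp h1
  unfold rate
  fun_prop

lemma rate_ge (U : Pos d → ℝ) (lref : ℝ) (x v : Pos d) : lref ≤ rate U lref x v := by
  unfold rate
  linarith [le_max_right (inner ℝ v (gradient U x)) 0]

lemma continuous_holdDensity {U : Pos d → ℝ} (hU : ContDiff ℝ 1 U) (lref : ℝ) :
    Continuous (fun p : State d × ℝ => holdDensity U lref p.1 p.2) := by
  have hr := continuous_rate hU lref
  have h1 : Continuous (fun p : State d × ℝ =>
      rate U lref (p.1.1 + p.2 • (p.1.2 : Pos d)) p.1.2) :=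
    hr.comp (f := fun p : State d × ℝ => (p.1.1 + p.2 • (p.1.2 : Pos d), (p.1.2 : Pos d)))
      (by fun_prop)
  have h2 : Continuous (fun p : State d × ℝ =>
      ∫ s in (0 : ℝ)..p.2, rate U lref (p.1.1 + s • (p.1.2 : Pos d)) p.1.2) := by
    apply intervalIntegral.continuous_parametric_intervalIntegral_of_continuous
    · exact hr.comp (f := fun q : (State d × ℝ) × ℝ =>
        (q.1.1.1 + q.2 • (q.1.1.2 : Pos d), (q.1.1.2 : Pos d))) (by fun_prop)
    · fun_prop
  unfold holdDensity
  exact h1.mul (Real.continuous_exp.comp h2.neg)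

lemma lintegral_holdDensity {U : Pos d → ℝ} (hU : ContDiff ℝ 1 U) {lref : ℝ} (hl : 0 < lref)
    (z : State d) :
    ∫⁻ t in Set.Ioi (0 : ℝ), ENNReal.ofReal (holdDensity U lref z t) = 1 := by
  set r : ℝ → ℝ := fun s => rate U lref (z.1 + s • (z.2 : Pos d)) z.2 with hrdef
  have hr : Continuous r := (continuous_rate hU lref).comp
    (f := fun s : ℝ => (z.1 + s • (z.2 : Pos d), (z.2 : Pos d))) (by fun_prop)
  have hge : ∀ s, lref ≤ r s := fun s => rate_ge _ _ _ _
  have hder : ∀ t ∈ Set.Ici (0 : ℝ), HasDerivAt (fun t => -Real.exp (-∫ s in (0 : ℝ)..t, r s))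
      (holdDensity U lref z t) t := by
    intro t _
    have h := (hr.integral_hasStrictDerivAt 0 t).hasDerivAt
    have h2 := h.neg.exp.neg
    refine h2.congr_deriv ?_
    simp only [holdDensity, hrdef, Pi.neg_apply]
    ring
  have hnn : ∀ t ∈ Set.Ioi (0 : ℝ), 0 ≤ holdDensity U lref z t := fun t _ =>
    mul_nonneg (hl.le.trans (rate_ge _ _ _ _)) (Real.exp_pos _).le
  have hlim : Tendsto (fun t => -Real.exp (-∫ s in (0 : ℝ)..t, r s)) atTop (nhds 0) := by
    have h1 : Tendsto (fun t => ∫ s in (0 : ℝ)..t, r s) atTop atTop := by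
      refine tendsto_atTop_mono' atTop ?_ (tendsto_id.const_mul_atTop hl)
      filter_upwards [eventually_ge_atTop (0 : ℝ)] with t ht
      have := intervalIntegral.integral_mono_on (μ := volume) ht (f := fun _ => lref) (g := r)
        intervalIntegrable_const (hr.intervalIntegrable _ _) (fun s _ => hge s)
      simpa [mul_comm] using this
    simpa using (Real.tendsto_exp_neg_atTop_nhds_zero.comp h1).neg
  have hint := integrableOn_Ioi_deriv_of_nonneg' hder hnn hlim
  have hval := integral_Ioi_of_hasDerivAt_of_nonneg' hder hnn hlim
  rw [← ofReal_integral_eq_lintegral_ofReal hint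
    ((ae_restrict_iff' measurableSet_Ioi).2 (Eventually.of_forall hnn)), hval]
  simp

lemma isMarkovKernel_holdKernel {U : Pos d → ℝ} (hU : ContDiff ℝ 1 U) {lref : ℝ} (hl : 0 < lref) :
    IsMarkovKernel (holdKernel U lref) := by
  refine ⟨fun z => ⟨?_⟩⟩
  have hm : Measurable (Function.uncurry
      (fun (z : State d) t => ENNReal.ofReal (holdDensity U lref z t))) :=
    ENNReal.measurable_ofReal.comp (continuous_holdDensity hU lref).measurable
  rw [holdKernel, Kernel.withDensity_apply' _ hm, Kernel.const_apply, Measure.restrict_univ,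
    lintegral_holdDensity hU hl]

instance : Nonempty (Vel d) := ⟨⟨0, by simp [velocities]⟩⟩

lemma isMarkovKernel_velKernel {U : Pos d → ℝ} (hU : ContDiff ℝ 1 U) {lref : ℝ} (hl : 0 < lref) :
    IsMarkovKernel (velKernel U lref) := by
  have hr := continuous_rate hU lref
  have hpos : ∀ x : Pos d, 0 < ∑ w' : Vel d, rate U lref x (-(w' : Pos d)) := fun x =>
    Finset.sum_pos (fun w _ => hl.trans_le (rate_ge _ _ _ _)) Finset.univ_nonempty
  have hc : Continuous (fun p : Pos d × Vel d => velProb U lref p.1 p.2) := by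
    unfold velProb
    refine Continuous.div ?_ ?_ (fun p => (hpos p.1).ne')
    · exact hr.comp (f := fun p : Pos d × Vel d => (p.1, -(p.2 : Pos d))) (by fun_prop)
    · refine continuous_finsetSum _ fun w _ => ?_
      exact hr.comp (f := fun p : Pos d × Vel d => (p.1, -(w : Pos d))) (by fun_prop)
  have hm : Measurable (Function.uncurry
      (fun (x : Pos d) (w : Vel d) => ENNReal.ofReal (velProb U lref x w))) :=
    ENNReal.measurable_ofReal.comp hc.measurable
  refine ⟨fun x => ⟨?_⟩⟩
  rw [velKernel, Kernel.withDensity_apply' _ hm, Kernel.const_apply, Measure.restrict_univ,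
    lintegral_count, tsum_fintype, ← ENNReal.ofReal_sum_of_nonneg]
  · simp only [velProb]
    rw [← Finset.sum_div, div_self (hpos x).ne', ENNReal.ofReal_one]
  · exact fun w _ => div_nonneg (hl.le.trans (rate_ge _ _ _ _)) (hpos x).le

lemma isMarkovKernel_stepKernel {U : Pos d → ℝ} (hU : ContDiff ℝ 1 U) {lref : ℝ} (hl : 0 < lref) :
    IsMarkovKernel (stepKernel U lref) := by
  have := isMarkovKernel_holdKernel hU hl
  have := isMarkovKernel_velKernel hU hl
  unfold stepKernel eventKernel
  exact Kernel.IsMarkovKernel.map _ measurable_nextMark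

/-- The kernels of the skeleton chain, as functions of the whole past: the next entry depends only
on the last one. -/
def pastKernel (U : Pos d → ℝ) (lref : ℝ) (n : ℕ) :
    Kernel ((i : Finset.Iic n) → Mark d) (Mark d) :=
  (stepKernel U lref).comap (fun h => h ⟨n, Finset.mem_Iic.2 le_rfl⟩) (measurable_pi_apply _)

/-- The law of the whole skeleton `(T_n, (X_{T_n}, V_{T_n}))_{n ≥ 0}` of the on-and-off coordinate
sampler, given its initial state. -/
def skeletonLaw {U : Pos d → ℝ} (hU : ContDiff ℝ 1 U) {lref : ℝ} (hl : 0 < lref) :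
    Kernel (State d) (ℕ → Mark d) :=
  haveI : IsMarkovKernel (stepKernel U lref) := isMarkovKernel_stepKernel hU hl
  haveI : ∀ n, IsMarkovKernel (pastKernel U lref n) := fun _ =>
    Kernel.IsMarkovKernel.comap _ (measurable_pi_apply _)
  (Kernel.traj (X := fun _ => Mark d) (pastKernel U lref) 0).comap
    (fun z _ => ((0 : ℝ), z)) (by fun_prop)

/-- The number of events up to time `t`, i.e. the first `n` with `t < T_{n+1}`. -/
def eventCount (ω : ℕ → Mark d) (t : ℝ) : ℕ := sInf {n | t < (ω (n + 1)).1}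

/-- The state `Z_t = (X_t, V_t)` of the process at time `t`: since the last event before `t` the
position has moved along the flow and the velocity has not changed. -/
def stateAt (t : ℝ) (ω : ℕ → Mark d) : State d :=
  (flowPos (ω (eventCount ω t)).2 (t - (ω (eventCount ω t)).1), (ω (eventCount ω t)).2.2)

/-- The transition kernel `P_t` of the on-and-off coordinate sampler: the law of `Z_t` given the
state at time `0`. -/
def transition {U : Pos d → ℝ} (hU : ContDiff ℝ 1 U) {lref : ℝ} (hl : 0 < lref) (t : ℝ) :
    Kernel (State d) (State d) :=
  (skeletonLaw hU hl).map (stateAt t)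

/-- The augmented target `π(x) φ(v)`, with `π(x) ∝ exp(-U(x))` and `φ` uniform on the velocity
set. -/
def target (U : Pos d → ℝ) : Measure (State d) :=
  ((volume : Measure (Pos d)).tilted (fun x => -U x)).prod (uniformOn (Set.univ : Set (Vel d)))

/-- The term `⟨∇_x f(x, v), v⟩`. -/
def drift (f : State d → ℝ) (z : State d) : ℝ :=
  inner ℝ (gradient (fun y => f (y, z.2)) z.1) (z.2 : Pos d)

/-- The generator
`L f(x, v) = ⟨∇_x f(x, v), v⟩ + λ(x, v) ∑_w λ(x, -w) / λ(x) f(x, w) - λ(x, v) f(x, v)`. -/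
def generator (U : Pos d → ℝ) (lref : ℝ) (f : State d → ℝ) (z : State d) : ℝ :=
  drift f z
    + rate U lref z.1 z.2 *
        ∑ w : Vel d, rate U lref z.1 (-(w : Pos d)) / totalRate U lref z.1 * f (z.1, w)
    - rate U lref z.1 z.2 * f z

/-- The functions to which the generator formula is applied: differentiable in the position, and
such that every term is integrable with respect to the augmented target. -/
structure Admissible (U : Pos d → ℝ) (lref : ℝ) (f : State d → ℝ) : Prop where
  differentiable : ∀ v : Vel d, Differentiable ℝ (fun x => f (x, v))
  integrable_drift : Integrable (drift f) (target U)
  integrable_rate : Integrable (fun z : State d => rate U lref z.1 z.2 * f z) (target U)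
  integrable_rate_neg :
    Integrable (fun z : State d => rate U lref z.1 (-(z.2 : Pos d)) * f z) (target U)

end

end IOCS

/-! Write `S (x, v) = (x, -v)`. Along a flight the rate difference `λ(x, v) - λ(x, -v) = ⟨v,
∇U(x)⟩` integrates to an increment of `U`, so the motion without events is in duality, with
respect to the target, with its conjugate by `S`. The rate `λ(x, v)` times the probability
proportional to `λ(x, -w)` is symmetric under `(v, w) ↦ (-w, -v)`, so the same holds for the
jumps. Expanding the transition kernel over the number of events (a Dyson series, convolutions in
time of flights and jumps), each term, hence the sum, is in duality with its conjugate by `S`. As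
this conjugate is Markov, testing the duality against `1` gives the invariance.

There is no explosion since the process has speed at most one: up to time `t` it stays in a ball,
on which the rates are bounded, so that `𝔼[exp (-T_n); T_n ≤ t]` decays geometrically in `n`.

For the generator, integration by parts turns the drift of `f` into `(λ(x, v) - λ(x, -v)) f`, and
the duality of the jumps turns the gain term into `λ(x, -v) f`, so everything cancels. -/

namespace IOCS

open scoped ENNReal

section Duality

variable {E : Type*} [MeasurableSpace E] {μ : Measure E} {κ η : Kernel E E}

/-- Duality of two kernels with respect to `μ`: they are adjoint to each other for the pairing
`∫ f g dμ` of nonnegative functions. Reversibility is the case `κ = η`. -/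
def InDuality (μ : Measure E) (κ η : Kernel E E) : Prop :=
  ∀ ⦃f g : E → ℝ≥0∞⦄, Measurable f → Measurable g →
    ∫⁻ z, f z * ∫⁻ y, g y ∂(κ z) ∂μ = ∫⁻ z, (∫⁻ y, f y ∂(η z)) * g z ∂μ

lemma InDuality.symm (h : InDuality μ κ η) : InDuality μ η κ := fun f g hf hg => by
  simpa only [mul_comm] using (h hg hf).symm

lemma InDuality.comp_eq_withDensity (h : InDuality μ κ η) :
    κ ∘ₘ μ = μ.withDensity fun z => η z Set.univ := by
  ext s hs
  rw [Measure.bind_apply hs κ.aemeasurable, withDensity_apply _ hs, ← lintegral_indicator hs]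
  have key := h measurable_one (measurable_one.indicator hs)
  simp only [Pi.one_apply, one_mul, lintegral_one, lintegral_indicator_one hs] at key
  refine key.trans (lintegral_congr fun z => ?_)
  by_cases hz : z ∈ s <;> simp [hz]

lemma InDuality.invariant [IsMarkovKernel η] (h : InDuality μ κ η) : Kernel.Invariant κ μ := by
  rw [Kernel.Invariant, h.comp_eq_withDensity]
  simp

lemma InDuality.integrable_comp (h : InDuality μ κ η)
    (hη : ∀ z, η z Set.univ < ∞) {f : E → ℝ}
    (hf : Integrable (fun z => (η z).real Set.univ * f z) μ) : Integrable f (κ ∘ₘ μ) := by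
  rw [h.comp_eq_withDensity, integrable_withDensity_iff_integrable_smul'
    (η.measurable_coe MeasurableSet.univ) (ae_of_all _ hη)]
  exact hf

lemma InDuality.integrable_integral (h : InDuality μ κ η)
    (hη : ∀ z, η z Set.univ < ∞) {f : E → ℝ}
    (hf : Integrable (fun z => (η z).real Set.univ * f z) μ) :
    Integrable (fun z => ∫ y, f y ∂(κ z)) μ := by
  have hcomp := h.integrable_comp hη hf
  rw [Measure.comp_eq_comp_const_apply] at hcomp
  exact hcomp.integral_comp

lemma InDuality.integral_integral (h : InDuality μ κ η)
    (hη : ∀ z, η z Set.univ < ∞) {f : E → ℝ}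
    (hf : Integrable (fun z => (η z).real Set.univ * f z) μ) :
    ∫ z, ∫ y, f y ∂(κ z) ∂μ = ∫ z, (η z).real Set.univ * f z ∂μ := by
  have hcomp := h.integrable_comp hη hf
  rw [Measure.comp_eq_comp_const_apply] at hcomp
  calc ∫ z, ∫ y, f y ∂(κ z) ∂μ
      = ∫ y, f y ∂(κ ∘ₘ μ) := by
        rw [Measure.comp_eq_comp_const_apply, Kernel.integral_comp hcomp, Kernel.const_apply]
    _ = ∫ z, (η z).real Set.univ * f z ∂μ := by
        rw [h.comp_eq_withDensity, integral_withDensity_eq_integral_toReal_smul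
          (η.measurable_coe MeasurableSet.univ) (ae_of_all _ hη)]
        rfl

end Duality

section Dyson

variable {E : Type*} [MeasurableSpace E]

/-- The expectation of `g` after a motion of duration `t` from `z`, as a function of `(t, z)`. -/
noncomputable def evolve (T : Kernel (ℝ × E) E) (g : E → ℝ≥0∞) (p : ℝ × E) : ℝ≥0∞ :=
  ∫⁻ y, g y ∂(T p)

/-- The convolution in time of the motion `T` with the function `Φ` of the remaining time and the
state. -/
noncomputable def convolve (T : Kernel (ℝ × E) E) (Φ : ℝ × E → ℝ≥0∞) (p : ℝ × E) : ℝ≥0∞ :=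
  ∫⁻ r, ∫⁻ y, Φ (p.1 - r, y) ∂(T (r, p.2))

/-- The action of a kernel on functions of time and state: it leaves the time unchanged. -/
noncomputable def jumpOp (J : Kernel E E) (Φ : ℝ × E → ℝ≥0∞) (p : ℝ × E) : ℝ≥0∞ :=
  ∫⁻ y, Φ (p.1, y) ∂(J p.2)

/-- The `n`-th term of the Dyson series of a motion `T` interrupted by jumps `J`: the contribution
to the expectation of `g` at time `t`, starting from `z`, of the paths with exactly `n` jumps, as a
function of `(t, z)`. -/
noncomputable def dysonTerm (T : Kernel (ℝ × E) E) (J : Kernel E E) (g : E → ℝ≥0∞) (n : ℕ) :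
    ℝ × E → ℝ≥0∞ :=
  (fun Φ => convolve T (jumpOp J Φ))^[n] (evolve T g)

/-- The space-time pairing for which convolutions with dual motions are adjoint. -/
noncomputable def pairing (μ : Measure E) (t : ℝ) (Φ Ψ : ℝ × E → ℝ≥0∞) : ℝ≥0∞ :=
  ∫⁻ s, ∫⁻ z, Φ (s, z) * Ψ (t - s, z) ∂μ

variable {μ : Measure E} {T T' : Kernel (ℝ × E) E} {J J' : Kernel E E} {Φ Ψ : ℝ × E → ℝ≥0∞}
  {f g : E → ℝ≥0∞}

lemma pairing_comm (t : ℝ) : pairing μ t Φ Ψ = pairing μ t Ψ Φ := by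
  unfold pairing
  rw [← lintegral_sub_left_eq_self _ t]
  simp only [sub_sub_cancel, mul_comm]

lemma dysonTerm_succ (T : Kernel (ℝ × E) E) (J : Kernel E E) (g : E → ℝ≥0∞) (n : ℕ) :
    dysonTerm T J g (n + 1) = convolve T (jumpOp J (dysonTerm T J g n)) :=
  Function.iterate_succ_apply' _ _ _

lemma measurable_evolve (hg : Measurable g) : Measurable (evolve T g) :=
  hg.lintegral_kernel

lemma measurable_jumpOp [IsSFiniteKernel J] (hΦ : Measurable Φ) : Measurable (jumpOp J Φ) :=
  Measurable.lintegral_kernel_prod_right' (κ := J.comap Prod.snd measurable_snd)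
    (f := fun q : (ℝ × E) × E => Φ (q.1.1, q.2)) (hΦ.comp (by fun_prop))

lemma measurable_lintegral_comap [IsSFiniteKernel T] {α : Type*} [MeasurableSpace α]
    {F : α × E → ℝ≥0∞} (hF : Measurable F) {k : α → ℝ × E} (hk : Measurable k) :
    Measurable fun a => ∫⁻ y, F (a, y) ∂(T (k a)) :=
  Measurable.lintegral_kernel_prod_right' (κ := T.comap k hk) hF

lemma measurable_convolve [IsSFiniteKernel T] (hΦ : Measurable Φ) : Measurable (convolve T Φ) :=
  Measurable.lintegral_prod_right'
    (f := fun q : (ℝ × E) × ℝ => ∫⁻ y, Φ (q.1.1 - q.2, y) ∂(T (q.2, q.1.2)))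
    (measurable_lintegral_comap (hΦ.comp (by fun_prop : Measurable
      fun q : ((ℝ × E) × ℝ) × E => (q.1.1.1 - q.1.2, q.2))) (by fun_prop))

lemma measurable_dysonTerm [IsSFiniteKernel T] [IsSFiniteKernel J] (hg : Measurable g) (n : ℕ) :
    Measurable (dysonTerm T J g n) := by
  induction n with
  | zero => exact measurable_evolve hg
  | succ n ih => rw [dysonTerm_succ]; exact measurable_convolve (measurable_jumpOp ih)

lemma lintegral_mul_convolve [SFinite μ] [IsSFiniteKernel T]
    (hT : ∀ r, InDuality μ (T.sectR r) (T'.sectR r)) (hf : Measurable f) (hΨ : Measurable Ψ)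
    (t : ℝ) : ∫⁻ z, f z * convolve T Ψ (t, z) ∂μ = pairing μ t (evolve T' f) Ψ := by
  have hm : Measurable fun q : E × ℝ => ∫⁻ y, Ψ (t - q.2, y) ∂(T (q.2, q.1)) :=
    measurable_lintegral_comap (F := fun q : (E × ℝ) × E => Ψ (t - q.1.2, q.2))
      (hΨ.comp (by fun_prop)) (by fun_prop)
  calc ∫⁻ z, f z * convolve T Ψ (t, z) ∂μ
      = ∫⁻ z, ∫⁻ r, f z * ∫⁻ y, Ψ (t - r, y) ∂(T (r, z)) ∂volume ∂μ :=
        lintegral_congr fun z => (lintegral_const_mul _ (hm.comp measurable_prodMk_left)).symm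
    _ = ∫⁻ r, ∫⁻ z, f z * ∫⁻ y, Ψ (t - r, y) ∂(T (r, z)) ∂μ :=
        lintegral_lintegral_swap ((hf.comp measurable_fst).mul hm).aemeasurable
    _ = pairing μ t (evolve T' f) Ψ :=
        lintegral_congr fun r => hT r hf (hΨ.comp measurable_prodMk_left)

lemma lintegral_convolve_mul [SFinite μ] [IsSFiniteKernel T']
    (hT : ∀ r, InDuality μ (T.sectR r) (T'.sectR r)) (hΦ : Measurable Φ) (hg : Measurable g)
    (t : ℝ) : ∫⁻ z, convolve T' Φ (t, z) * g z ∂μ = pairing μ t Φ (evolve T g) := by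
  simp only [mul_comm _ (g _)]
  rw [lintegral_mul_convolve (fun r => (hT r).symm) hg hΦ, pairing_comm]

lemma pairing_convolve [SFinite μ] [IsSFiniteKernel T] [IsSFiniteKernel T']
    (hT : ∀ r, InDuality μ (T.sectR r) (T'.sectR r)) (hΦ : Measurable Φ) (hΨ : Measurable Ψ)
    (t : ℝ) : pairing μ t Φ (convolve T Ψ) = pairing μ t (convolve T' Φ) Ψ := by
  have hm : Measurable fun q : (ℝ × ℝ) × E =>
      (∫⁻ y, Φ (q.1.1, y) ∂(T' (q.1.2, q.2))) * Ψ (t - q.1.1 - q.1.2, q.2) :=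
    (measurable_lintegral_comap (F := fun q : ((ℝ × ℝ) × E) × E => Φ (q.1.1.1, q.2))
      (hΦ.comp (by fun_prop)) (by fun_prop)).mul (hΨ.comp (by fun_prop))
  have hm' (s : ℝ) : Measurable fun q : ℝ × E =>
      (∫⁻ y, Φ (s - q.1, y) ∂(T' (q.1, q.2))) * Ψ (t - s, q.2) :=
    (measurable_lintegral_comap (F := fun q : (ℝ × E) × E => Φ (s - q.1.1, q.2))
      (hΦ.comp (by fun_prop)) (by fun_prop)).mul (hΨ.comp (by fun_prop))
  calc pairing μ t Φ (convolve T Ψ)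
      = ∫⁻ s, ∫⁻ r, ∫⁻ z, (∫⁻ y, Φ (s, y) ∂(T' (r, z))) * Ψ (t - s - r, z) ∂μ :=
        lintegral_congr fun s => lintegral_mul_convolve hT (hΦ.comp measurable_prodMk_left) hΨ _
    _ = ∫⁻ r, ∫⁻ s, ∫⁻ z, (∫⁻ y, Φ (s, y) ∂(T' (r, z))) * Ψ (t - s - r, z) ∂μ :=
        lintegral_lintegral_swap hm.lintegral_prod_right'.aemeasurable
    _ = ∫⁻ r, ∫⁻ s, ∫⁻ z, (∫⁻ y, Φ (s - r, y) ∂(T' (r, z))) * Ψ (t - s, z) ∂μ := by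
        refine lintegral_congr fun r => ?_
        rw [← lintegral_sub_right_eq_self _ r]
        simp only [sub_sub, sub_add_cancel]
    _ = ∫⁻ s, ∫⁻ r, ∫⁻ z, (∫⁻ y, Φ (s - r, y) ∂(T' (r, z))) * Ψ (t - s, z) ∂μ := by
        refine lintegral_lintegral_swap (Measurable.aemeasurable ?_)
        refine Measurable.lintegral_prod_right' (f := fun q : (ℝ × ℝ) × E =>
          (∫⁻ y, Φ (q.1.2 - q.1.1, y) ∂(T' (q.1.1, q.2))) * Ψ (t - q.1.2, q.2)) ?_
        exact (measurable_lintegral_comap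
          (F := fun q : ((ℝ × ℝ) × E) × E => Φ (q.1.1.2 - q.1.1.1, q.2))
          (hΦ.comp (by fun_prop)) (by fun_prop)).mul (hΨ.comp (by fun_prop))
    _ = pairing μ t (convolve T' Φ) Ψ := by
        refine lintegral_congr fun s => ?_
        rw [lintegral_lintegral_swap (hm' s).aemeasurable]
        refine lintegral_congr fun z => lintegral_mul_const _ ?_
        exact measurable_lintegral_comap (F := fun q : ℝ × E => Φ (s - q.1, q.2))
          (hΦ.comp (by fun_prop)) (by fun_prop)

lemma pairing_jumpOp (hJ : InDuality μ J J') (hΦ : Measurable Φ) (hΨ : Measurable Ψ) (t : ℝ) :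
    pairing μ t Φ (jumpOp J Ψ) = pairing μ t (jumpOp J' Φ) Ψ :=
  lintegral_congr fun _ =>
    hJ (hΦ.comp measurable_prodMk_left) (hΨ.comp measurable_prodMk_left)

variable [SFinite μ] [IsSFiniteKernel T] [IsSFiniteKernel T'] [IsSFiniteKernel J]
  [IsSFiniteKernel J']

lemma pairing_jumpOp_dysonTerm (hT : ∀ r, InDuality μ (T.sectR r) (T'.sectR r))
    (hJ : InDuality μ J J') (hf : Measurable f) (hΨ : Measurable Ψ) (t : ℝ) (n : ℕ) :
    pairing μ t (evolve T' f) (jumpOp J ((fun Φ => convolve T (jumpOp J Φ))^[n] Ψ)) =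
      pairing μ t (jumpOp J' (dysonTerm T' J' f n)) Ψ := by
  induction n generalizing Ψ with
  | zero => exact pairing_jumpOp hJ (measurable_evolve hf) hΨ t
  | succ n ih =>
    have hD : Measurable (dysonTerm T' J' f n) := measurable_dysonTerm hf n
    have hJΨ : Measurable (jumpOp J Ψ) := measurable_jumpOp hΨ
    rw [Function.iterate_succ_apply, ih (measurable_convolve hJΨ),
      pairing_convolve hT (measurable_jumpOp hD) hJΨ, ← dysonTerm_succ,
      pairing_jumpOp hJ (measurable_dysonTerm hf _) hΨ]

lemma lintegral_mul_dysonTerm (hT : ∀ r, InDuality μ (T.sectR r) (T'.sectR r))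
    (hJ : InDuality μ J J') (hf : Measurable f) (hg : Measurable g) (t : ℝ) (n : ℕ) :
    ∫⁻ z, f z * dysonTerm T J g n (t, z) ∂μ = ∫⁻ z, dysonTerm T' J' f n (t, z) * g z ∂μ := by
  cases n with
  | zero => exact hT t hf hg
  | succ n =>
    rw [dysonTerm_succ, dysonTerm_succ,
      lintegral_mul_convolve hT hf (measurable_jumpOp (measurable_dysonTerm hg n)),
      lintegral_convolve_mul hT (measurable_jumpOp (measurable_dysonTerm hf n)) hg]
    exact pairing_jumpOp_dysonTerm hT hJ hf (measurable_evolve hg) t n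

end Dyson

section Conjugation

variable {α E : Type*} [MeasurableSpace α] [MeasurableSpace E]

/-- The conjugate `z ↦ σ (κ (ρ⁻¹ z))` of a kernel by bijections of its source and target. -/
noncomputable def conj (ρ : α ≃ᵐ α) (σ : E ≃ᵐ E) (κ : Kernel α E) : Kernel α E :=
  (κ.comap ρ.symm ρ.symm.measurable).map σ

instance (ρ : α ≃ᵐ α) (σ : E ≃ᵐ E) (κ : Kernel α E) [IsSFiniteKernel κ] :
    IsSFiniteKernel (conj ρ σ κ) :=
  Kernel.IsSFiniteKernel.map _ _

instance (ρ : α ≃ᵐ α) (σ : E ≃ᵐ E) (κ : Kernel α E) [IsMarkovKernel κ] :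
    IsMarkovKernel (conj ρ σ κ) :=
  Kernel.IsMarkovKernel.map _ σ.measurable

lemma lintegral_conj (ρ : α ≃ᵐ α) (σ : E ≃ᵐ E) (κ : Kernel α E) (f : E → ℝ≥0∞) (a : α) :
    ∫⁻ y, f y ∂(conj ρ σ κ a) = ∫⁻ y, f (σ y) ∂(κ (ρ.symm a)) := by
  rw [conj, Kernel.map_apply _ σ.measurable, lintegral_map_equiv, Kernel.comap_apply]

/-- The action of a bijection of the state space on space-time. -/
def timeExtend (σ : E ≃ᵐ E) : ℝ × E ≃ᵐ ℝ × E := (MeasurableEquiv.refl ℝ).prodCongr σ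

lemma dysonTerm_conj (σ : E ≃ᵐ E) (T : Kernel (ℝ × E) E) (J : Kernel E E) (g : E → ℝ≥0∞)
    (n : ℕ) (p : ℝ × E) :
    dysonTerm (conj (timeExtend σ) σ T) (conj σ σ J) g n p =
      dysonTerm T J (g ∘ σ) n ((timeExtend σ).symm p) := by
  induction n generalizing p with
  | zero => exact lintegral_conj _ _ _ _ _
  | succ n ih =>
    simp only [dysonTerm_succ, convolve, jumpOp, lintegral_conj, ih]
    simp [timeExtend, MeasurableEquiv.prodCongr]

end Conjugation

section Hazard

variable {r : ℝ → ℝ}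

/-- The density of the first event time of a Poisson process with intensity `r`. -/
noncomputable def hazardDensity (r : ℝ → ℝ) (t : ℝ) : ℝ :=
  r t * Real.exp (-∫ s in (0 : ℝ)..t, r s)

lemma continuous_hazardDensity (hr : Continuous r) : Continuous (hazardDensity r) :=
  hr.mul (Real.continuous_exp.comp
    (intervalIntegral.continuous_primitive (fun a b => hr.intervalIntegrable a b) 0).neg)

lemma tendsto_intervalIntegral_atTop_of_le (hr : Continuous r) {c : ℝ} (hc : 0 < c)
    (h : ∀ s, c ≤ r s) : Tendsto (fun t => ∫ s in (0 : ℝ)..t, r s) atTop atTop := by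
  refine tendsto_atTop_mono' atTop ?_ (tendsto_id.const_mul_atTop hc)
  filter_upwards [eventually_ge_atTop 0] with t ht
  simpa [mul_comm] using intervalIntegral.integral_mono_on (μ := volume) ht (f := fun _ => c)
    intervalIntegrable_const (hr.intervalIntegrable _ _) fun s _ => h s

lemma setLIntegral_Ioi_hazardDensity (hr : Continuous r) (h0 : ∀ s, 0 ≤ r s)
    (hinf : Tendsto (fun t => ∫ s in (0 : ℝ)..t, r s) atTop atTop) (a : ℝ) :
    ∫⁻ t in Set.Ioi a, ENNReal.ofReal (hazardDensity r t) =
      ENNReal.ofReal (Real.exp (-∫ s in (0 : ℝ)..a, r s)) := by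
  have hderiv : ∀ t ∈ Set.Ici a, HasDerivAt (fun t => -Real.exp (-∫ s in (0 : ℝ)..t, r s))
      (hazardDensity r t) t := fun t _ => by
    refine (hr.integral_hasStrictDerivAt 0 t).hasDerivAt.neg.exp.neg.congr_deriv ?_
    simp only [hazardDensity, Pi.neg_apply]
    ring
  have hnonneg : ∀ t ∈ Set.Ioi a, 0 ≤ hazardDensity r t := fun t _ =>
    mul_nonneg (h0 t) (Real.exp_pos _).le
  have hlim : Tendsto (fun t => -Real.exp (-∫ s in (0 : ℝ)..t, r s)) atTop (nhds 0) := by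
    simpa using (Real.tendsto_exp_neg_atTop_nhds_zero.comp hinf).neg
  rw [← ofReal_integral_eq_lintegral_ofReal (integrableOn_Ioi_deriv_of_nonneg' hderiv hnonneg hlim)
      (ae_restrict_of_forall_mem measurableSet_Ioi hnonneg),
    integral_Ioi_of_hasDerivAt_of_nonneg' hderiv hnonneg hlim, zero_sub, neg_neg]

lemma hazardDensity_add_one (hr : Continuous r) (t : ℝ) :
    hazardDensity (fun s => r s + 1) t =
      (r t + 1) * (Real.exp (-∫ s in (0 : ℝ)..t, r s) * Real.exp (-t)) := by
  rw [hazardDensity, intervalIntegral.integral_add (hr.intervalIntegrable _ _)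
    intervalIntegrable_const, ← Real.exp_add]
  simp [add_comm]

/-- The function `s ↦ 1_{s ≤ T} exp(-s)` of an event time, whose expectation at the successive
events measures how likely they are to occur before `T`. -/
noncomputable def discount (T s : ℝ) : ℝ≥0∞ :=
  (Set.Iic T).indicator (fun s => ENNReal.ofReal (Real.exp (-s))) s

lemma measurable_discount (T : ℝ) : Measurable (discount T) :=
  Measurable.indicator (by fun_prop) measurableSet_Iic

lemma discount_of_le {T s : ℝ} (h : s ≤ T) : discount T s = ENNReal.ofReal (Real.exp (-s)) :=
  Set.indicator_of_mem (Set.mem_Iic.2 h) _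

lemma discount_of_lt {T s : ℝ} (h : T < s) : discount T s = 0 :=
  Set.indicator_of_notMem (by simpa using h) _

lemma discount_add (T a s : ℝ) :
    discount T (a + s) = ENNReal.ofReal (Real.exp (-a)) * discount (T - a) s := by
  rcases le_or_gt s (T - a) with h | h
  · rw [discount_of_le h, discount_of_le (by linarith), neg_add, Real.exp_add,
      ENNReal.ofReal_mul (Real.exp_pos _).le]
  · rw [discount_of_lt h, discount_of_lt (by linarith), mul_zero]

/- Discounting by `exp(-s)` amounts to adding an independent killing at rate one, and at any time
the event wins against the killing with odds at most `M : 1`. -/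
lemma lintegral_hazardDensity_mul_discount_le (hr : Continuous r) (h0 : ∀ s, 0 ≤ r s) {M T : ℝ}
    (hM0 : 0 ≤ M) (hM : ∀ s, 0 < s → s ≤ T → r s ≤ M) :
    ∫⁻ s in Set.Ioi 0, ENNReal.ofReal (hazardDensity r s) * discount T s ≤
      ENNReal.ofReal (M / (M + 1)) := by
  have hr' : Continuous fun s => r s + 1 := by fun_prop
  have hratio : 0 ≤ M / (M + 1) := by positivity
  have hbound : ∀ s ∈ Set.Ioi (0 : ℝ), ENNReal.ofReal (hazardDensity r s) * discount T s ≤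
      ENNReal.ofReal (M / (M + 1)) * ENNReal.ofReal (hazardDensity (fun s => r s + 1) s) := by
    intro s hs
    rcases le_or_gt s T with h | h
    · have hodds : r s ≤ M / (M + 1) * (r s + 1) := by
        rw [div_mul_eq_mul_div, le_div_iff₀ (by positivity)]
        linarith [hM s hs h]
      rw [discount_of_le h, ← ENNReal.ofReal_mul' (Real.exp_pos _).le,
        ← ENNReal.ofReal_mul hratio, hazardDensity_add_one hr, hazardDensity, mul_assoc,
        ← mul_assoc (M / (M + 1))]
      gcongr
    · simp [discount_of_lt h]
  have hmass : ∫⁻ s in Set.Ioi 0, ENNReal.ofReal (hazardDensity (fun s => r s + 1) s) = 1 := by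
    have hinf := tendsto_intervalIntegral_atTop_of_le hr' one_pos fun s => by linarith [h0 s]
    rw [setLIntegral_Ioi_hazardDensity hr' (fun s => by linarith [h0 s]) hinf]
    simp
  calc ∫⁻ s in Set.Ioi 0, ENNReal.ofReal (hazardDensity r s) * discount T s
      ≤ ∫⁻ s in Set.Ioi 0, ENNReal.ofReal (M / (M + 1)) *
          ENNReal.ofReal (hazardDensity (fun s => r s + 1) s) :=
        setLIntegral_mono' measurableSet_Ioi hbound
    _ = ENNReal.ofReal (M / (M + 1)) := by
        rw [lintegral_const_mul _ (continuous_hazardDensity hr').measurable.ennreal_ofReal, hmass,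
          mul_one]

end Hazard

section Trajectory

lemma map_traj_succ {E : Type*} [MeasurableSpace E]
    {κ : (n : ℕ) → Kernel ((i : Finset.Iic n) → E) E} [∀ n, IsMarkovKernel (κ n)]
    {η : Kernel E E} [IsSFiniteKernel η] {a n : ℕ} (han : a ≤ n)
    (hη : ∀ h, κ n h = η (h ⟨n, Finset.mem_Iic.2 le_rfl⟩)) (x₀ : (i : Finset.Iic a) → E) :
    (Kernel.traj (X := fun _ => E) κ a x₀).map (fun ω => (ω n, ω (n + 1))) =
      (Kernel.traj (X := fun _ => E) κ a x₀).map (fun ω => ω n) ⊗ₘ η := by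
  refine Measure.ext_of_lintegral _ fun F hF => ?_
  have hF' : Measurable fun p : ((i : Finset.Iic n) → E) × E =>
      F (p.1 ⟨n, Finset.mem_Iic.2 le_rfl⟩, p.2) := hF.comp (by fun_prop)
  have key := congrArg (fun ν => ∫⁻ p, F (p.1 ⟨n, Finset.mem_Iic.2 le_rfl⟩, p.2) ∂ν)
    (Kernel.partialTraj_compProd_eq_map_traj (X := fun _ => E) (κ := κ) han (x₀ := x₀))
  rw [Measure.lintegral_compProd hF', ← Kernel.traj_map_frestrictLe_apply,
    lintegral_map (Measurable.lintegral_kernel_prod_right' hF') (by fun_prop),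
    lintegral_map hF' (by fun_prop)] at key
  rw [Measure.lintegral_compProd hF, lintegral_map hF (by fun_prop),
    lintegral_map (Measurable.lintegral_kernel_prod_right' hF) (by fun_prop)]
  simp only [hη] at key
  exact key.symm

lemma ae_traj_frestrictLe_eq {X : ℕ → Type*} [∀ n, MeasurableSpace (X n)]
    {κ : (n : ℕ) → Kernel ((i : Finset.Iic n) → X i) (X (n + 1))} [∀ n, IsMarkovKernel (κ n)]
    [∀ n, MeasurableSingletonClass (X n)] (a : ℕ) (x₀ : (i : Finset.Iic a) → X i) :
    ∀ᵐ ω ∂(Kernel.traj κ a x₀), Preorder.frestrictLe a ω = x₀ := by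
  refine ae_of_ae_map (p := fun x => x = x₀) (by fun_prop) ?_
  rw [Kernel.traj_map_frestrictLe_apply, Kernel.partialTraj_self, Kernel.id_apply]
  exact (ae_dirac_iff (measurableSet_singleton x₀)).2 rfl

end Trajectory

lemma measurable_sInf_setOf {α : Type*} [MeasurableSpace α] {p : ℕ → α → Prop}
    (hp : ∀ n, MeasurableSet {a | p n a}) : Measurable fun a => sInf {n | p n a} := by
  refine measurable_of_Iic fun n => ?_
  have : (fun a => sInf {n | p n a}) ⁻¹' Set.Iic n =
      (⋃ k ∈ Set.Iic n, {a | p k a}) ∪ ⋂ k, {a | p k a}ᶜ := by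
    ext a
    simp only [Set.mem_preimage, Set.mem_Iic, Set.mem_union, Set.mem_iUnion, Set.mem_iInter,
      Set.mem_compl_iff, Set.mem_ofPred_eq, exists_prop]
    constructor
    · intro h
      rcases Set.eq_empty_or_nonempty {n | p n a} with h' | h'
      · exact Or.inr fun k hk => (h' ▸ hk : k ∈ (∅ : Set ℕ))
      · exact Or.inl ⟨_, h, Nat.sInf_mem h'⟩
    · rintro (⟨k, hk, hpk⟩ | h)
      · exact (Nat.sInf_le hpk).trans hk
      · simp [h]
  rw [this]
  exact (MeasurableSet.biUnion (Set.to_countable _) fun k _ => hp k).union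
    (MeasurableSet.iInter fun k => (hp k).compl)

variable {d : ℕ} {U : Pos d → ℝ} {lref : ℝ}

section Step

/-- The event rate `s ↦ λ(x + s v, v)` met along the flow from `(x, v)`. -/
noncomputable def intensity (U : Pos d → ℝ) (lref : ℝ) (z : State d) (s : ℝ) : ℝ :=
  rate U lref (flowPos z s) z.2

lemma rate_nonneg (hl : 0 < lref) (x v : Pos d) : 0 ≤ rate U lref x v :=
  hl.le.trans (rate_ge _ _ _ _)

lemma continuous_rate_coe (hU : ContDiff ℝ 1 U) (lref : ℝ) :
    Continuous fun z : State d => rate U lref z.1 z.2 :=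
  (continuous_rate hU lref).comp (f := fun z : State d => (z.1, (z.2 : Pos d))) (by fun_prop)

lemma continuous_rate_neg_coe (hU : ContDiff ℝ 1 U) (lref : ℝ) :
    Continuous fun z : State d => rate U lref z.1 (-(z.2 : Pos d)) :=
  (continuous_rate hU lref).comp (f := fun z : State d => (z.1, -(z.2 : Pos d))) (by fun_prop)

lemma continuous_flowPos : Continuous fun p : State d × ℝ => flowPos p.1 p.2 := by
  unfold flowPos
  fun_prop

lemma continuous_intensity (hU : ContDiff ℝ 1 U) (lref : ℝ) :
    Continuous fun p : State d × ℝ => intensity U lref p.1 p.2 :=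
  (continuous_rate hU lref).comp
    (f := fun p : State d × ℝ => (flowPos p.1 p.2, (p.1.2 : Pos d)))
    (continuous_flowPos.prodMk (by fun_prop))

lemma continuous_intensity_right (hU : ContDiff ℝ 1 U) (lref : ℝ) (z : State d) :
    Continuous (intensity U lref z) :=
  (continuous_intensity hU lref).comp (f := fun s => (z, s)) (by fun_prop)

lemma measurable_velProb (hU : ContDiff ℝ 1 U) (lref : ℝ) :
    Measurable fun p : State d => velProb U lref p.1 p.2 := by
  unfold velProb
  refine (continuous_rate_neg_coe hU lref).measurable.div
    (Finset.measurable_sum _ fun w _ => Continuous.measurable ?_)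
  exact (continuous_rate_neg_coe hU lref).comp (f := fun p : State d => (p.1, w)) (by fun_prop)

lemma lintegral_velKernel (hU : ContDiff ℝ 1 U) (lref : ℝ) (x : Pos d) (F : Vel d → ℝ≥0∞) :
    ∫⁻ w, F w ∂(velKernel U lref x) = ∑ w, ENNReal.ofReal (velProb U lref x w) * F w := by
  have hm : Measurable (Function.uncurry fun (x : Pos d) (w : Vel d) =>
      ENNReal.ofReal (velProb U lref x w)) := (measurable_velProb hU lref).ennreal_ofReal
  rw [velKernel, Kernel.lintegral_withDensity _ hm _ (measurable_of_finite F), Kernel.const_apply,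
    lintegral_count, tsum_fintype]

lemma lintegral_holdKernel (hU : ContDiff ℝ 1 U) (lref : ℝ) (z : State d) {F : ℝ → ℝ≥0∞}
    (hF : Measurable F) :
    ∫⁻ r, F r ∂(holdKernel U lref z) =
      ∫⁻ r in Set.Ioi 0, ENNReal.ofReal (hazardDensity (intensity U lref z) r) * F r := by
  have hm : Measurable (Function.uncurry fun (z : State d) t =>
      ENNReal.ofReal (holdDensity U lref z t)) :=
    (continuous_holdDensity hU lref).measurable.ennreal_ofReal
  rw [holdKernel, Kernel.lintegral_withDensity _ hm _ hF, Kernel.const_apply]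
  rfl

lemma lintegral_stepKernel (hU : ContDiff ℝ 1 U) (hl : 0 < lref) (m : Mark d)
    {F : Mark d → ℝ≥0∞} (hF : Measurable F) :
    ∫⁻ y, F y ∂(stepKernel U lref m) =
      ∫⁻ r in Set.Ioi 0, ENNReal.ofReal (hazardDensity (intensity U lref m.2) r) *
        ∫⁻ w, F (m.1 + r, (flowPos m.2 r, w)) ∂(velKernel U lref (flowPos m.2 r)) := by
  have := isMarkovKernel_holdKernel hU hl
  have := isMarkovKernel_velKernel hU hl
  have hG : Measurable fun q : ℝ × Vel d => F (nextMark (m, q)) :=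
    hF.comp (measurable_nextMark.comp (by fun_prop))
  have hflow : Measurable (flowPos m.2) :=
    (continuous_flowPos.comp (by fun_prop : Continuous fun r : ℝ => (m.2, r))).measurable
  unfold stepKernel eventKernel
  rw [Kernel.map_apply _ measurable_nextMark, lintegral_map hF measurable_nextMark,
    Kernel.prod_apply, Kernel.id_apply, Measure.dirac_prod,
    lintegral_map (f := fun a => F (nextMark a)) (hF.comp measurable_nextMark) (by fun_prop),
    Kernel.comap_apply, Kernel.lintegral_compProd _ _ _ hG]
  exact lintegral_holdKernel hU lref m.2
    (Measurable.lintegral_kernel_prod_right' (κ := (velKernel U lref).comap _ hflow) hG)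

lemma lintegral_stepKernel_fst (hU : ContDiff ℝ 1 U) (hl : 0 < lref) (m : Mark d) {F : ℝ → ℝ≥0∞}
    (hF : Measurable F) :
    ∫⁻ y, F y.1 ∂(stepKernel U lref m) =
      ∫⁻ r in Set.Ioi 0, ENNReal.ofReal (hazardDensity (intensity U lref m.2) r) *
        F (m.1 + r) := by
  have := isMarkovKernel_velKernel hU hl
  rw [lintegral_stepKernel hU hl m (F := fun y => F y.1) (hF.comp measurable_fst)]
  simp

lemma norm_vel_le_one (v : Vel d) : ‖(v : Pos d)‖ ≤ 1 := by
  obtain ⟨v, hv⟩ := v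
  simp only [velocities, Finset.mem_insert, Finset.mem_union, Finset.mem_image, Finset.mem_univ,
    true_and] at hv
  rcases hv with rfl | ⟨i, rfl⟩ | ⟨i, rfl⟩ <;> simp

lemma norm_flowPos_sub_le (z : State d) {r : ℝ} (hr : 0 ≤ r) : ‖flowPos z r - z.1‖ ≤ r := by
  rw [flowPos, add_sub_cancel_left, norm_smul, Real.norm_of_nonneg hr]
  exact mul_le_of_le_one_right hr (norm_vel_le_one _)

/-- A step of the skeleton which takes a positive time and moves at speed at most one. -/
def IsUnitSpeedStep (m y : Mark d) : Prop :=
  m.1 < y.1 ∧ ‖y.2.1 - m.2.1‖ ≤ y.1 - m.1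

lemma measurableSet_isUnitSpeedStep :
    MeasurableSet {p : Mark d × Mark d | IsUnitSpeedStep p.1 p.2} :=
  (measurableSet_lt (f := fun p : Mark d × Mark d => p.1.1) (g := fun p => p.2.1)
      (by fun_prop) (by fun_prop)).inter
    (measurableSet_le (f := fun p : Mark d × Mark d => ‖p.2.2.1 - p.1.2.1‖)
      (g := fun p => p.2.1 - p.1.1) (by fun_prop) (by fun_prop))

lemma ae_stepKernel_isUnitSpeedStep (hU : ContDiff ℝ 1 U) (hl : 0 < lref) (m : Mark d) :
    ∀ᵐ y ∂(stepKernel U lref m), IsUnitSpeedStep m y := by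
  have hs : MeasurableSet {y | IsUnitSpeedStep m y}ᶜ :=
    (measurable_prodMk_left measurableSet_isUnitSpeedStep).compl
  change stepKernel U lref m {y | IsUnitSpeedStep m y}ᶜ = 0
  rw [← lintegral_indicator_one hs, lintegral_stepKernel hU hl m (measurable_one.indicator hs)]
  refine setLIntegral_eq_zero measurableSet_Ioi fun r (hr : 0 < r) => ?_
  have hstep (w : Vel d) : IsUnitSpeedStep m (m.1 + r, (flowPos m.2 r, w)) :=
    ⟨lt_add_of_pos_right _ hr, by simpa using norm_flowPos_sub_le m.2 hr.le⟩
  simp [hstep]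

end Step

section Skeleton

lemma isMarkovKernel_pastKernel (hU : ContDiff ℝ 1 U) (hl : 0 < lref) (n : ℕ) :
    IsMarkovKernel (pastKernel U lref n) :=
  haveI := isMarkovKernel_stepKernel hU hl
  Kernel.IsMarkovKernel.comap _ (measurable_pi_apply _)

lemma isMarkovKernel_skeletonLaw (hU : ContDiff ℝ 1 U) (hl : 0 < lref) :
    IsMarkovKernel (skeletonLaw hU hl) := by
  have := isMarkovKernel_pastKernel hU hl
  have : IsMarkovKernel (Kernel.traj (X := fun _ => Mark d) (pastKernel U lref) 0) :=
    inferInstance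
  exact Kernel.IsMarkovKernel.comap _ _

lemma map_skeletonLaw_succ (hU : ContDiff ℝ 1 U) (hl : 0 < lref) (z : State d) (n : ℕ) :
    (skeletonLaw hU hl z).map (fun ω => (ω n, ω (n + 1))) =
      (skeletonLaw hU hl z).map (fun ω => ω n) ⊗ₘ stepKernel U lref :=
  haveI := isMarkovKernel_stepKernel hU hl
  haveI := isMarkovKernel_pastKernel hU hl
  map_traj_succ (Nat.zero_le n) (fun _ => rfl) _

lemma lintegral_skeletonLaw_succ (hU : ContDiff ℝ 1 U) (hl : 0 < lref) (z : State d) (n : ℕ)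
    {F : Mark d × Mark d → ℝ≥0∞} (hF : Measurable F) :
    ∫⁻ ω, F (ω n, ω (n + 1)) ∂(skeletonLaw hU hl z) =
      ∫⁻ ω, ∫⁻ y, F (ω n, y) ∂(stepKernel U lref (ω n)) ∂(skeletonLaw hU hl z) := by
  have := isMarkovKernel_stepKernel hU hl
  have := isMarkovKernel_skeletonLaw hU hl
  rw [← lintegral_map (f := F) hF (by fun_prop), map_skeletonLaw_succ,
    Measure.lintegral_compProd hF,
    lintegral_map (Measurable.lintegral_kernel_prod_right' hF) (by fun_prop)]

lemma ae_skeletonLaw_zero (hU : ContDiff ℝ 1 U) (hl : 0 < lref) (z : State d) :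
    ∀ᵐ ω ∂(skeletonLaw hU hl z), ω 0 = (0, z) := by
  have := isMarkovKernel_pastKernel hU hl
  filter_upwards [ae_traj_frestrictLe_eq (X := fun _ => Mark d) (κ := pastKernel U lref) 0
    fun _ => (0, z)] with ω hω
  exact congrFun hω ⟨0, Finset.mem_Iic.2 le_rfl⟩

lemma ae_skeletonLaw_isUnitSpeedStep (hU : ContDiff ℝ 1 U) (hl : 0 < lref) (z : State d) :
    ∀ᵐ ω ∂(skeletonLaw hU hl z), ∀ n, IsUnitSpeedStep (ω n) (ω (n + 1)) := by
  have := isMarkovKernel_stepKernel hU hl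
  have := isMarkovKernel_skeletonLaw hU hl
  refine ae_all_iff.2 fun n => ?_
  refine ae_of_ae_map (f := fun ω : ℕ → Mark d => (ω n, ω (n + 1)))
    (p := fun q => IsUnitSpeedStep q.1 q.2) (by fun_prop) ?_
  rw [map_skeletonLaw_succ]
  exact Measure.ae_compProd_of_ae_ae measurableSet_isUnitSpeedStep
    (ae_of_all _ fun m => ae_stepKernel_isUnitSpeedStep hU hl m)

lemma ae_skeletonLaw_strictMono (hU : ContDiff ℝ 1 U) (hl : 0 < lref) (z : State d) :
    ∀ᵐ ω ∂(skeletonLaw hU hl z), StrictMono fun n => (ω n).1 := by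
  filter_upwards [ae_skeletonLaw_isUnitSpeedStep hU hl z] with ω h
  exact strictMono_nat_of_lt_succ fun n => (h n).1

lemma ae_skeletonLaw_norm_sub_le (hU : ContDiff ℝ 1 U) (hl : 0 < lref) (z : State d) :
    ∀ᵐ ω ∂(skeletonLaw hU hl z), ∀ n, ‖(ω n).2.1 - z.1‖ ≤ (ω n).1 := by
  filter_upwards [ae_skeletonLaw_zero hU hl z, ae_skeletonLaw_isUnitSpeedStep hU hl z] with ω h0 h n
  induction n with
  | zero => simp [h0]
  | succ n ih =>
    linarith [norm_sub_le_norm_sub_add_norm_sub (ω (n + 1)).2.1 (ω n).2.1 z.1, (h n).2]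

end Skeleton

section NonExplosion

lemma exists_rate_le (hU : ContDiff ℝ 1 U) (lref : ℝ) (x : Pos d) (T : ℝ) :
    ∃ M : ℝ, 0 ≤ M ∧ ∀ y, ‖y - x‖ ≤ T → ∀ v : Vel d, rate U lref y v ≤ M := by
  have hc : IsCompact (Metric.closedBall x T ×ˢ Metric.closedBall (0 : Pos d) 1) :=
    (isCompact_closedBall x T).prod (isCompact_closedBall _ _)
  obtain ⟨M, hM⟩ := hc.bddAbove_image (continuous_rate hU lref).continuousOn
  refine ⟨max M 0, le_max_right _ _, fun y hy v => le_max_of_le_left (hM ⟨(y, v), ⟨?_, ?_⟩, rfl⟩)⟩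
  · simpa [dist_eq_norm] using hy
  · simpa using norm_vel_le_one v

lemma lintegral_discount_stepKernel_le (hU : ContDiff ℝ 1 U) (hl : 0 < lref) {x : Pos d} {T M : ℝ}
    (hM0 : 0 ≤ M) (hM : ∀ y, ‖y - x‖ ≤ T → ∀ v : Vel d, rate U lref y v ≤ M) {m : Mark d}
    (hm : ‖m.2.1 - x‖ ≤ m.1) :
    ∫⁻ y, discount T y.1 ∂(stepKernel U lref m) ≤
      ENNReal.ofReal (M / (M + 1)) * discount T m.1 := by
  have hrate : ∀ s, 0 < s → s ≤ T - m.1 → intensity U lref m.2 s ≤ M := fun s hs hsT => by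
    refine hM _ ?_ _
    linarith [norm_sub_le_norm_sub_add_norm_sub (flowPos m.2 s) m.2.1 x,
      norm_flowPos_sub_le m.2 hs.le]
  have hhazard := lintegral_hazardDensity_mul_discount_le (continuous_intensity_right hU lref m.2)
    (fun s => rate_nonneg hl _ _) hM0 hrate
  rw [lintegral_stepKernel_fst hU hl m (measurable_discount T)]
  rcases le_or_gt m.1 T with hT | hT
  · simp only [discount_add T m.1, mul_left_comm _ (ENNReal.ofReal (Real.exp (-m.1)))]
    rw [lintegral_const_mul' _ _ ENNReal.ofReal_ne_top, discount_of_le hT, mul_comm]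
    gcongr
  · refine (setLIntegral_eq_zero measurableSet_Ioi fun r (hr : 0 < r) => ?_).trans_le zero_le
    simp [discount_of_lt (hT.trans (lt_add_of_pos_right _ hr))]

lemma lintegral_discount_skeletonLaw_le (hU : ContDiff ℝ 1 U) (hl : 0 < lref) (z : State d)
    {T M : ℝ} (hM0 : 0 ≤ M) (hM : ∀ y, ‖y - z.1‖ ≤ T → ∀ v : Vel d, rate U lref y v ≤ M) (n : ℕ) :
    ∫⁻ ω, discount T (ω n).1 ∂(skeletonLaw hU hl z) ≤ ENNReal.ofReal (M / (M + 1)) ^ n := by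
  have := isMarkovKernel_skeletonLaw hU hl
  induction n with
  | zero =>
    refine (lintegral_mono_ae (g := fun _ => 1) ?_).trans (by simp)
    filter_upwards [ae_skeletonLaw_zero hU hl z] with ω h0
    rcases le_or_gt 0 T with h | h <;> simp [h0, discount_of_le, discount_of_lt, h]
  | succ n ih =>
    rw [lintegral_skeletonLaw_succ hU hl z n (F := fun q => discount T q.2.1)
      ((measurable_discount T).comp (by fun_prop))]
    calc ∫⁻ ω, ∫⁻ y, discount T y.1 ∂(stepKernel U lref (ω n)) ∂(skeletonLaw hU hl z)
        ≤ ∫⁻ ω, ENNReal.ofReal (M / (M + 1)) * discount T (ω n).1 ∂(skeletonLaw hU hl z) := by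
          refine lintegral_mono_ae ?_
          filter_upwards [ae_skeletonLaw_norm_sub_le hU hl z] with ω h
          exact lintegral_discount_stepKernel_le hU hl hM0 hM (h n)
      _ = ENNReal.ofReal (M / (M + 1)) * ∫⁻ ω, discount T (ω n).1 ∂(skeletonLaw hU hl z) :=
          lintegral_const_mul' _ _ ENNReal.ofReal_ne_top
      _ ≤ ENNReal.ofReal (M / (M + 1)) ^ (n + 1) := by rw [pow_succ']; gcongr

lemma ae_skeletonLaw_exists_lt (hU : ContDiff ℝ 1 U) (hl : 0 < lref) (z : State d) (T : ℝ) :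
    ∀ᵐ ω ∂(skeletonLaw hU hl z), ∃ n, T < (ω n).1 := by
  obtain ⟨M, hM0, hM⟩ := exists_rate_le hU lref z.1 T
  have hlt : ENNReal.ofReal (M / (M + 1)) < 1 := by
    rw [ENNReal.ofReal_lt_one, div_lt_one (by positivity)]
    linarith
  set A := {ω : ℕ → Mark d | ∃ n, T < (ω n).1}ᶜ
  have hA : MeasurableSet A := by
    have : MeasurableSet (⋃ n, {ω : ℕ → Mark d | T < (ω n).1}) :=
      MeasurableSet.iUnion fun n => measurableSet_lt (by fun_prop) (by fun_prop)
    simpa only [A, Set.ofPred_exists] using this.compl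
  have hle (n : ℕ) : ENNReal.ofReal (Real.exp (-T)) * skeletonLaw hU hl z A ≤
      ENNReal.ofReal (M / (M + 1)) ^ n := by
    refine le_trans ?_ (lintegral_discount_skeletonLaw_le hU hl z hM0 hM n)
    rw [← lintegral_indicator_const hA]
    refine lintegral_mono (Set.indicator_le fun ω hω => ?_)
    have hT : (ω n).1 ≤ T := not_lt.1 fun h => hω ⟨n, h⟩
    rw [discount_of_le hT]
    gcongr
  have h0 := ge_of_tendsto' (ENNReal.tendsto_pow_atTop_nhds_zero_of_lt_one hlt) hle
  exact (mul_eq_zero.1 (nonpos_iff_eq_zero.1 h0)).resolve_left (by simp [Real.exp_pos])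

lemma ae_skeletonLaw_tendsto (hU : ContDiff ℝ 1 U) (hl : 0 < lref) (z : State d) :
    ∀ᵐ ω ∂(skeletonLaw hU hl z), Tendsto (fun n => (ω n).1) atTop atTop := by
  filter_upwards [ae_skeletonLaw_strictMono hU hl z,
    ae_all_iff.2 fun k : ℕ => ae_skeletonLaw_exists_lt hU hl z k] with ω hmono hk
  refine tendsto_atTop_atTop_of_monotone hmono.monotone fun b => ?_
  obtain ⟨k, hbk⟩ := exists_nat_ge b
  obtain ⟨n, hn⟩ := hk k
  exact ⟨n, hbk.trans hn.le⟩

end NonExplosion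

section FlightAndJump

/-- The probability that no event occurs within a duration `r` from `z`, and `0` for `r < 0`. -/
noncomputable def survival (U : Pos d → ℝ) (lref : ℝ) (z : State d) (r : ℝ) : ℝ≥0∞ :=
  if 0 ≤ r then ENNReal.ofReal (Real.exp (-∫ s in (0 : ℝ)..r, intensity U lref z s)) else 0

lemma survival_ne_top (U : Pos d → ℝ) (lref : ℝ) (z : State d) (r : ℝ) :
    survival U lref z r ≠ ∞ := by
  unfold survival
  split_ifs <;> simp

lemma measurable_survival (hU : ContDiff ℝ 1 U) (lref : ℝ) :
    Measurable fun p : ℝ × State d => survival U lref p.2 p.1 := by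
  have hc : Continuous fun p : ℝ × State d =>
      ∫ s in (0 : ℝ)..p.1, intensity U lref p.2 s := by
    refine intervalIntegral.continuous_parametric_intervalIntegral_of_continuous ?_ (by fun_prop)
    exact (continuous_intensity hU lref).comp
      (f := fun q : (ℝ × State d) × ℝ => (q.1.2, q.2)) (by fun_prop)
  exact Measurable.ite (measurableSet_le measurable_const measurable_fst)
    (Real.continuous_exp.comp hc.neg).measurable.ennreal_ofReal measurable_const

lemma ofReal_hazardDensity_intensity (U : Pos d → ℝ) (lref : ℝ) (z : State d) {r : ℝ} (hr : 0 ≤ r) :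
    ENNReal.ofReal (hazardDensity (intensity U lref z) r) =
      survival U lref z r * ENNReal.ofReal (rate U lref (flowPos z r) z.2) := by
  rw [survival, if_pos hr, hazardDensity, mul_comm, ENNReal.ofReal_mul (Real.exp_pos _).le]
  rfl

lemma measurable_flow : Measurable fun p : ℝ × State d => (flowPos p.2 p.1, p.2.2) :=
  (continuous_flowPos.comp
    (f := fun p : ℝ × State d => (p.2, p.1)) (by fun_prop)).measurable.prodMk (by fun_prop)

/-- The motion along the flow, restricted to the event that no jump occurs; as a kernel from pairs
`(r, z)` of a duration and an initial state. -/
noncomputable def flightKernel (U : Pos d → ℝ) (lref : ℝ) : Kernel (ℝ × State d) (State d) :=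
  (Kernel.deterministic _ measurable_flow).withDensity fun p _ => survival U lref p.2 p.1

instance : IsSFiniteKernel (flightKernel U lref) :=
  Kernel.IsSFiniteKernel.withDensity _ fun _ _ => survival_ne_top _ _ _ _

lemma lintegral_flightKernel (hU : ContDiff ℝ 1 U) (lref : ℝ) {φ : State d → ℝ≥0∞}
    (hφ : Measurable φ) (p : ℝ × State d) :
    ∫⁻ y, φ y ∂(flightKernel U lref p) =
      survival U lref p.2 p.1 * φ (flowPos p.2 p.1, p.2.2) := by
  have hm : Measurable (Function.uncurry fun (p : ℝ × State d) (_ : State d) =>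
      survival U lref p.2 p.1) := (measurable_survival hU lref).comp measurable_fst
  rw [flightKernel, Kernel.lintegral_withDensity _ hm _ hφ,
    Kernel.lintegral_deterministic' _ (hφ.const_mul _)]

instance : IsSFiniteKernel (velKernel U lref) :=
  Kernel.IsSFiniteKernel.withDensity _ fun _ _ => ENNReal.ofReal_ne_top

/-- The jump part of the dynamics: the law of the state after an event, multiplied by the event
rate. -/
noncomputable def jumpKernel (U : Pos d → ℝ) (lref : ℝ) : Kernel (State d) (State d) :=
  (Kernel.deterministic Prod.fst measurable_fst ×ₖ
    (velKernel U lref).comap Prod.fst measurable_fst).withDensity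
      fun z _ => ENNReal.ofReal (rate U lref z.1 z.2)

instance : IsSFiniteKernel (jumpKernel U lref) :=
  Kernel.IsSFiniteKernel.withDensity _ fun _ _ => ENNReal.ofReal_ne_top

lemma lintegral_jumpKernel (hU : ContDiff ℝ 1 U) (lref : ℝ) {φ : State d → ℝ≥0∞}
    (hφ : Measurable φ) (z : State d) :
    ∫⁻ y, φ y ∂(jumpKernel U lref z) =
      ENNReal.ofReal (rate U lref z.1 z.2) * ∫⁻ w, φ (z.1, w) ∂(velKernel U lref z.1) := by
  have hm : Measurable (Function.uncurry fun (z _ : State d) =>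
      ENNReal.ofReal (rate U lref z.1 z.2)) :=
    (continuous_rate_coe hU lref).measurable.ennreal_ofReal.comp measurable_fst
  rw [jumpKernel, Kernel.lintegral_withDensity _ hm _ hφ,
    lintegral_const_mul _ hφ, Kernel.prod_apply, Kernel.deterministic_apply, Kernel.comap_apply,
    Measure.dirac_prod, lintegral_map hφ (by fun_prop)]

end FlightAndJump

section Transition

lemma measurable_eventCount (t : ℝ) : Measurable fun ω : ℕ → Mark d => eventCount ω t :=
  measurable_sInf_setOf fun _ => measurableSet_lt measurable_const (by fun_prop)

lemma measurable_stateAt (t : ℝ) : Measurable (stateAt (d := d) t) := by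
  have h : Measurable fun q : (ℕ → Mark d) × ℕ =>
      ((flowPos (q.1 q.2).2 (t - (q.1 q.2).1), (q.1 q.2).2.2) : State d) := by
    refine measurable_from_prod_countable_left fun n => ?_
    exact measurable_flow.comp
      (f := fun ω : ℕ → Mark d => (t - (ω n).1, (ω n).2)) (by fun_prop)
  exact h.comp (measurable_id.prodMk (measurable_eventCount t))

lemma isMarkovKernel_transition (hU : ContDiff ℝ 1 U) (hl : 0 < lref) (t : ℝ) :
    IsMarkovKernel (transition hU hl t) :=
  haveI := isMarkovKernel_skeletonLaw hU hl
  Kernel.IsMarkovKernel.map _ (measurable_stateAt t)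

lemma stepKernel_setOf_lt (hU : ContDiff ℝ 1 U) (hl : 0 < lref) (m : Mark d) {t : ℝ}
    (hm : m.1 ≤ t) : stepKernel U lref m {y | t < y.1} = survival U lref m.2 (t - m.1) := by
  have hcont := continuous_intensity_right hU lref m.2
  calc stepKernel U lref m {y | t < y.1}
      = ∫⁻ y, (Set.Ioi t).indicator 1 y.1 ∂(stepKernel U lref m) :=
        (lintegral_indicator_one (measurable_fst measurableSet_Ioi)).symm
    _ = ∫⁻ r in Set.Ioi 0, (Set.Ioi (t - m.1)).indicator
          (fun r => ENNReal.ofReal (hazardDensity (intensity U lref m.2) r)) r := by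
        rw [lintegral_stepKernel_fst hU hl m (measurable_one.indicator measurableSet_Ioi)]
        refine lintegral_congr fun r => ?_
        simp [Set.indicator, sub_lt_iff_lt_add']
    _ = ∫⁻ r in Set.Ioi (t - m.1), ENNReal.ofReal (hazardDensity (intensity U lref m.2) r) := by
        rw [setLIntegral_indicator measurableSet_Ioi, Set.Ioi_inter_Ioi,
          sup_of_le_left (sub_nonneg.2 hm)]
    _ = survival U lref m.2 (t - m.1) := by
        rw [survival, if_pos (sub_nonneg.2 hm), setLIntegral_Ioi_hazardDensity hcont
          (fun s => rate_nonneg hl _ _)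
          (tendsto_intervalIntegral_atTop_of_le hcont hl fun s => rate_ge _ _ _ _)]

lemma lintegral_stepKernel_eq_convolve (hU : ContDiff ℝ 1 U) (hl : 0 < lref)
    {Φ : ℝ × State d → ℝ≥0∞} (hΦ : Measurable Φ) (t : ℝ) (m : Mark d) :
    ∫⁻ y, Φ (t - y.1, y.2) ∂(stepKernel U lref m) =
      convolve (flightKernel U lref) (jumpOp (jumpKernel U lref) Φ) (t - m.1, m.2) := by
  rw [lintegral_stepKernel hU hl m (F := fun y => Φ (t - y.1, y.2)) (hΦ.comp (by fun_prop)),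
    ← lintegral_indicator measurableSet_Ioi, convolve]
  refine lintegral_congr_ae ?_
  filter_upwards [Measure.ae_ne volume 0] with r hr
  have hJ : Measurable fun y => jumpOp (jumpKernel U lref) Φ (t - m.1 - r, y) :=
    (measurable_jumpOp hΦ).comp measurable_prodMk_left
  have hslice : Measurable fun y => Φ (t - m.1 - r, y) := hΦ.comp measurable_prodMk_left
  rw [lintegral_flightKernel hU lref hJ, jumpOp, lintegral_jumpKernel hU lref hslice]
  rcases lt_or_gt_of_ne hr with h | h
  · simp [survival, h, h.le]
  · simp only [Set.indicator_of_mem (Set.mem_Ioi.2 h), ofReal_hazardDensity_intensity U lref _ h.le,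
      mul_assoc, sub_sub]

lemma lintegral_dysonTerm_skeletonLaw (hU : ContDiff ℝ 1 U) (hl : 0 < lref) {g : State d → ℝ≥0∞}
    (hg : Measurable g) (z : State d) (t : ℝ) (n k : ℕ) :
    ∫⁻ ω, dysonTerm (flightKernel U lref) (jumpKernel U lref) g k (t - (ω n).1, (ω n).2)
        ∂(skeletonLaw hU hl z) =
      dysonTerm (flightKernel U lref) (jumpKernel U lref) g (k + n) (t, z) := by
  have := isMarkovKernel_skeletonLaw hU hl
  induction n generalizing k with
  | zero =>
    rw [lintegral_congr_ae (g := fun _ =>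
      dysonTerm (flightKernel U lref) (jumpKernel U lref) g k (t, z))]
    · simp
    · filter_upwards [ae_skeletonLaw_zero hU hl z] with ω h0
      simp [h0]
  | succ n ih =>
    have hD : Measurable (dysonTerm (flightKernel U lref) (jumpKernel U lref) g k) :=
      measurable_dysonTerm hg k
    rw [lintegral_skeletonLaw_succ hU hl z n
      (F := fun q => dysonTerm _ _ g k (t - q.2.1, q.2.2)) (hD.comp (by fun_prop))]
    simp only [lintegral_stepKernel_eq_convolve hU hl hD, ← dysonTerm_succ]
    rw [ih (k + 1), Nat.add_right_comm, Nat.add_assoc]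

/-- The contribution to `g(Z_t)` of two successive skeleton entries: it vanishes unless `t` lies
between their times. -/
noncomputable def betweenEvents (g : State d → ℝ≥0∞) (t : ℝ) (q : Mark d × Mark d) : ℝ≥0∞ :=
  if q.1.1 ≤ t ∧ t < q.2.1 then g (flowPos q.1.2 (t - q.1.1), q.1.2.2) else 0

lemma measurable_betweenEvents {g : State d → ℝ≥0∞} (hg : Measurable g) (t : ℝ) :
    Measurable (betweenEvents g t) :=
  Measurable.ite (MeasurableSet.inter
      (measurableSet_le (f := fun q : Mark d × Mark d => q.1.1) (by fun_prop) measurable_const)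
      (measurableSet_lt (g := fun q : Mark d × Mark d => q.2.1) measurable_const (by fun_prop)))
    (hg.comp (measurable_flow.comp
      (f := fun q : Mark d × Mark d => (t - q.1.1, q.1.2)) (by fun_prop))) measurable_const

lemma eventCount_spec {t : ℝ} {ω : ℕ → Mark d} (h0 : (ω 0).1 ≤ t)
    (htop : Tendsto (fun n => (ω n).1) atTop atTop) :
    (ω (eventCount ω t)).1 ≤ t ∧ t < (ω (eventCount ω t + 1)).1 := by
  have hne : {n | t < (ω (n + 1)).1}.Nonempty :=
    (((tendsto_add_atTop_iff_nat 1).2 htop).eventually_gt_atTop t).exists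
  refine ⟨?_, Nat.sInf_mem hne⟩
  rcases h : eventCount ω t with _ | k
  · exact h0
  · exact not_lt.1 (Nat.notMem_of_lt_sInf (s := {n | t < (ω (n + 1)).1})
      (show k < eventCount ω t by omega))

lemma apply_stateAt_eq_tsum (g : State d → ℝ≥0∞) {t : ℝ} {ω : ℕ → Mark d}
    (h0 : (ω 0).1 ≤ t) (hmono : StrictMono fun n => (ω n).1)
    (htop : Tendsto (fun n => (ω n).1) atTop atTop) :
    g (stateAt t ω) = ∑' n, betweenEvents g t (ω n, ω (n + 1)) := by
  have hspec := eventCount_spec h0 htop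
  rw [tsum_eq_single (eventCount ω t)]
  · exact (if_pos hspec).symm
  · refine fun n hn => if_neg fun h => hn ?_
    have h₁ : n < eventCount ω t + 1 := hmono.lt_iff_lt.1 (h.1.trans_lt hspec.2)
    have h₂ : eventCount ω t < n + 1 := hmono.lt_iff_lt.1 (hspec.1.trans_lt h.2)
    omega

lemma lintegral_betweenEvents_stepKernel (hU : ContDiff ℝ 1 U) (hl : 0 < lref)
    {g : State d → ℝ≥0∞} (hg : Measurable g) (t : ℝ) (m : Mark d) :
    ∫⁻ y, betweenEvents g t (m, y) ∂(stepKernel U lref m) =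
      evolve (flightKernel U lref) g (t - m.1, m.2) := by
  rw [evolve, lintegral_flightKernel hU lref hg]
  by_cases hm : m.1 ≤ t
  · have hs : MeasurableSet {y : Mark d | t < y.1} :=
      measurableSet_lt measurable_const measurable_fst
    rw [← stepKernel_setOf_lt hU hl m hm, mul_comm, ← lintegral_indicator_const hs]
    refine lintegral_congr fun y => ?_
    simp [betweenEvents, Set.indicator, hm]
  · simp [betweenEvents, survival, hm]

lemma lintegral_transition (hU : ContDiff ℝ 1 U) (hl : 0 < lref) {t : ℝ} (ht : 0 ≤ t)
    {g : State d → ℝ≥0∞} (hg : Measurable g) (z : State d) :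
    ∫⁻ y, g y ∂(transition hU hl t z) =
      ∑' n, dysonTerm (flightKernel U lref) (jumpKernel U lref) g n (t, z) := by
  have hb := measurable_betweenEvents hg t
  calc ∫⁻ y, g y ∂(transition hU hl t z)
      = ∫⁻ ω, g (stateAt t ω) ∂(skeletonLaw hU hl z) := by
        rw [transition, Kernel.map_apply _ (measurable_stateAt t),
          lintegral_map hg (measurable_stateAt t)]
    _ = ∫⁻ ω, ∑' n, betweenEvents g t (ω n, ω (n + 1)) ∂(skeletonLaw hU hl z) := by
        refine lintegral_congr_ae ?_
        filter_upwards [ae_skeletonLaw_zero hU hl z, ae_skeletonLaw_strictMono hU hl z,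
          ae_skeletonLaw_tendsto hU hl z] with ω h0 hmono htop
        exact apply_stateAt_eq_tsum g (by simpa [h0] using ht) hmono htop
    _ = ∑' n, ∫⁻ ω, evolve (flightKernel U lref) g (t - (ω n).1, (ω n).2)
          ∂(skeletonLaw hU hl z) := by
        have hbn (n : ℕ) : Measurable fun ω : ℕ → Mark d => betweenEvents g t (ω n, ω (n + 1)) :=
          hb.comp (by fun_prop)
        rw [lintegral_tsum fun n => (hbn n).aemeasurable]
        simp only [lintegral_skeletonLaw_succ hU hl z _ hb,
          lintegral_betweenEvents_stepKernel hU hl hg]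
    _ = ∑' n, dysonTerm (flightKernel U lref) (jumpKernel U lref) g n (t, z) :=
        tsum_congr fun n => by
          simpa only [Nat.zero_add] using! lintegral_dysonTerm_skeletonLaw hU hl hg z t n 0

end Transition

section Reversal

lemma neg_mem_velocities {v : Pos d} (hv : v ∈ velocities d) : -v ∈ velocities d := by
  simp only [velocities, Finset.mem_insert, Finset.mem_union, Finset.mem_image, Finset.mem_univ,
    true_and] at hv ⊢
  rcases hv with rfl | ⟨i, rfl⟩ | ⟨i, rfl⟩
  · simp
  · exact Or.inr (Or.inr ⟨i, rfl⟩)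
  · exact Or.inr (Or.inl ⟨i, by simp⟩)

/-- The opposite velocity. -/
def oppVel (v : Vel d) : Vel d := ⟨-v, neg_mem_velocities v.2⟩

@[simp] lemma coe_oppVel (v : Vel d) : (oppVel v : Pos d) = -v := rfl

@[simp] lemma oppVel_oppVel (v : Vel d) : oppVel (oppVel v) = v := by ext1; simp

lemma sum_oppVel {M : Type*} [AddCommMonoid M] (F : Vel d → M) :
    ∑ v, F (oppVel v) = ∑ v, F v :=
  Equiv.sum_comp (Function.Involutive.toPerm oppVel oppVel_oppVel) F

/-- The reversal of the velocity, `(x, v) ↦ (x, -v)`. -/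
def reverse : State d ≃ᵐ State d where
  toFun z := (z.1, oppVel z.2)
  invFun z := (z.1, oppVel z.2)
  left_inv z := by simp
  right_inv z := by simp
  measurable_toFun := measurable_fst.prodMk ((measurable_of_finite oppVel).comp measurable_snd)
  measurable_invFun := measurable_fst.prodMk ((measurable_of_finite oppVel).comp measurable_snd)

@[simp] lemma reverse_apply (z : State d) : reverse z = (z.1, oppVel z.2) := rfl

@[simp] lemma reverse_symm : (reverse (d := d)).symm = reverse := rfl

end Reversal

section TargetDuality

lemma lintegral_uniformOn_univ {V : Type*} [MeasurableSpace V] [MeasurableSingletonClass V]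
    [Fintype V] (F : V → ℝ≥0∞) :
    ∫⁻ v, F v ∂(uniformOn Set.univ) = (∑ v, F v) * (Fintype.card V : ℝ≥0∞)⁻¹ := by
  rw [lintegral_fintype, Finset.sum_mul]
  simp [uniformOn_univ]

lemma rate_mul_velProb (U : Pos d → ℝ) (hl : 0 < lref) (x : Pos d) (v w : Vel d) :
    ENNReal.ofReal (rate U lref x v) * ENNReal.ofReal (velProb U lref x w) =
      ENNReal.ofReal (rate U lref x (oppVel w)) * ENNReal.ofReal (velProb U lref x (oppVel v)) := by
  rw [← ENNReal.ofReal_mul (rate_nonneg hl _ _), ← ENNReal.ofReal_mul (rate_nonneg hl _ _)]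
  simp only [velProb, coe_oppVel, neg_neg]
  congr 1
  ring

lemma sum_mul_lintegral_jumpKernel (hU : ContDiff ℝ 1 U) (hl : 0 < lref) {f g : State d → ℝ≥0∞}
    (hf : Measurable f) (hg : Measurable g) (x : Pos d) :
    ∑ v, f (x, v) * ∫⁻ y, g y ∂(jumpKernel U lref (x, v)) =
      ∑ v, (∫⁻ y, f y ∂(conj reverse reverse (jumpKernel U lref) (x, v))) * g (x, v) := by
  have hf' : Measurable fun z : State d => f (z.1, oppVel z.2) := hf.comp reverse.measurable
  simp only [lintegral_conj, lintegral_jumpKernel hU lref hg, reverse_symm, reverse_apply,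
    lintegral_jumpKernel hU lref hf', lintegral_velKernel hU, Finset.mul_sum, Finset.sum_mul]
  rw [Finset.sum_comm]
  refine Finset.sum_congr rfl fun w _ => ?_
  rw [← sum_oppVel fun v => _ * (_ * f (x, oppVel v)) * g (x, w)]
  refine Finset.sum_congr rfl fun v _ => ?_
  rw [← mul_assoc _ _ (g (x, w)), rate_mul_velProb U hl]
  simp only [oppVel_oppVel]
  ring

lemma inDuality_jumpKernel (hU : ContDiff ℝ 1 U) (hl : 0 < lref) (μ : Measure (Pos d)) :
    InDuality (μ.prod (uniformOn (Set.univ : Set (Vel d)))) (jumpKernel U lref)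
      (conj reverse reverse (jumpKernel U lref)) := fun f g hf hg => by
  rw [lintegral_prod _ (hf.fun_mul hg.lintegral_kernel).aemeasurable,
    lintegral_prod _ (hf.lintegral_kernel.fun_mul hg).aemeasurable]
  simp only [lintegral_uniformOn_univ, sum_mul_lintegral_jumpKernel hU hl hf hg]

lemma rate_sub_rate_neg (U : Pos d → ℝ) (lref : ℝ) (x v : Pos d) :
    rate U lref x v - rate U lref x (-v) = inner ℝ v (gradient U x) := by
  simp only [rate, inner_neg_left, add_sub_add_right_eq_sub,
    max_zero_sub_max_neg_zero_eq_self]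

lemma hasDerivAt_comp_flowPos (hU : ContDiff ℝ 1 U) (lref : ℝ) (z : State d) (s : ℝ) :
    HasDerivAt (fun s => U (flowPos z s))
      (intensity U lref z s - rate U lref (flowPos z s) (-(z.2 : Pos d))) s := by
  have hflow : HasDerivAt (flowPos z) (z.2 : Pos d) s := by
    simpa only [one_smul] using! ((hasDerivAt_id s).smul_const (z.2 : Pos d)).const_add z.1
  have hgrad := ((hU.differentiable one_ne_zero) (flowPos z s)).hasGradientAt.hasFDerivAt
  refine (hgrad.comp_hasDerivAt s hflow).congr_deriv ?_
  rw [intensity, rate_sub_rate_neg, InnerProductSpace.toDual_apply_apply, real_inner_comm]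

lemma integral_intensity_reverse (U : Pos d → ℝ) (lref : ℝ) (z : State d) (r : ℝ) :
    ∫ s in (0 : ℝ)..r, intensity U lref (flowPos z r, oppVel z.2) s =
      ∫ s in (0 : ℝ)..r, rate U lref (flowPos z s) (-(z.2 : Pos d)) := by
  have hsub := intervalIntegral.integral_comp_sub_left (a := 0) (b := r)
    (fun s => rate U lref (flowPos z s) (-(z.2 : Pos d))) r
  rw [sub_self, sub_zero] at hsub
  rw [← hsub]
  refine intervalIntegral.integral_congr fun s _ => ?_
  have hpos : flowPos (flowPos z r, oppVel z.2) s = flowPos z (r - s) := by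
    simp only [flowPos, coe_oppVel]
    module
  simp only [intensity, hpos, coe_oppVel]

lemma potential_add_integral_intensity (hU : ContDiff ℝ 1 U) (lref : ℝ) (z : State d) (r : ℝ) :
    U z.1 + ∫ s in (0 : ℝ)..r, intensity U lref z s =
      U (flowPos z r) +
        ∫ s in (0 : ℝ)..r, intensity U lref (flowPos z r, oppVel z.2) s := by
  have hforward := continuous_intensity_right hU lref z
  have hbackward : Continuous fun s => rate U lref (flowPos z s) (-(z.2 : Pos d)) :=
    (continuous_rate_neg_coe hU lref).comp (f := fun s => (flowPos z s, z.2))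
      ((continuous_flowPos.comp (f := fun s : ℝ => (z, s)) (by fun_prop)).prodMk
        continuous_const)
  have h := intervalIntegral.integral_eq_sub_of_hasDerivAt (a := 0) (b := r)
    (fun s _ => hasDerivAt_comp_flowPos hU lref z s)
    ((hforward.sub hbackward).intervalIntegrable _ _)
  rw [intervalIntegral.integral_sub (hforward.intervalIntegrable _ _)
    (hbackward.intervalIntegrable _ _), ← integral_intensity_reverse] at h
  have h0 : flowPos z 0 = z.1 := by simp [flowPos]
  rw [h0] at h
  linarith

lemma exp_mul_survival (hU : ContDiff ℝ 1 U) (lref : ℝ) (z : State d) (r : ℝ) :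
    ENNReal.ofReal (Real.exp (-U z.1)) * survival U lref z r =
      ENNReal.ofReal (Real.exp (-U (flowPos z r))) *
        survival U lref (flowPos z r, oppVel z.2) r := by
  unfold survival
  split_ifs
  · rw [← ENNReal.ofReal_mul (Real.exp_pos _).le, ← ENNReal.ofReal_mul (Real.exp_pos _).le,
      ← Real.exp_add, ← Real.exp_add, ← neg_add, ← neg_add,
      potential_add_integral_intensity hU]
  · simp

instance (U : Pos d → ℝ) : SFinite (target U) := inferInstanceAs (SFinite (Measure.prod _ _))

lemma lintegral_target (hU : ContDiff ℝ 1 U) {F : State d → ℝ≥0∞} (hF : Measurable F) :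
    ∫⁻ z, F z ∂(target U) =
      (∑ v, ∫⁻ x, ENNReal.ofReal (Real.exp (-U x)) * F (x, v)) *
        (ENNReal.ofReal (∫ x, Real.exp (-U x))⁻¹ * (Fintype.card (Vel d) : ℝ≥0∞)⁻¹) := by
  have hc := hU.continuous
  rw [target, lintegral_prod_symm' _ hF, lintegral_uniformOn_univ, ← mul_assoc]
  congr 1
  rw [Finset.sum_mul]
  refine Finset.sum_congr rfl fun v _ => ?_
  have hm : Measurable fun x => ENNReal.ofReal (Real.exp (-U x)) * F (x, v) :=
    Measurable.mul (by fun_prop) (hF.comp measurable_prodMk_right)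
  rw [lintegral_tilted, ← lintegral_mul_const _ hm]
  simp only [div_eq_mul_inv, ENNReal.ofReal_mul (Real.exp_pos _).le, mul_right_comm]

lemma inDuality_flightKernel (hU : ContDiff ℝ 1 U) (lref : ℝ) (r : ℝ) :
    InDuality (target U) ((flightKernel U lref).sectR r)
      ((conj (timeExtend reverse) reverse (flightKernel U lref)).sectR r) := fun f g hf hg => by
  rw [lintegral_target hU (hf.fun_mul hg.lintegral_kernel),
    lintegral_target hU (hf.lintegral_kernel.fun_mul hg)]
  congr 1
  refine Finset.sum_congr rfl fun v _ => ?_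
  rw [← lintegral_add_right_eq_self
    (fun x => _ * ((∫⁻ y, f y ∂((conj _ _ (flightKernel U lref)).sectR r (x, v))) * g (x, v)))
    (r • (v : Pos d))]
  refine lintegral_congr fun x => ?_
  have hf' : Measurable fun z => f (reverse z) := hf.comp reverse.measurable
  have hsymm (z : State d) : (timeExtend reverse).symm (r, z) = (r, reverse z) := rfl
  have hback : flowPos (flowPos (x, v) r, oppVel v) r = x := by simp [flowPos]
  have key := exp_mul_survival hU lref (x, v) r
  rw [show x + r • (v : Pos d) = flowPos (x, v) r from rfl]
  simp only [Kernel.sectR_apply, lintegral_conj, hsymm, lintegral_flightKernel hU lref hg,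
    lintegral_flightKernel hU lref hf']
  simp only [reverse_apply, oppVel_oppVel, hback]
  rw [mul_left_comm, ← mul_assoc _ (survival _ _ _ _), key]
  ring

lemma inDuality_transition (hU : ContDiff ℝ 1 U) (hl : 0 < lref) {t : ℝ} (ht : 0 ≤ t) :
    InDuality (target U) (transition hU hl t)
      (conj reverse reverse (transition hU hl t)) := fun f g hf hg => by
  set T := flightKernel U lref
  set J := jumpKernel U lref
  have hf' : Measurable fun z => f (reverse z) := hf.comp reverse.measurable
  have hD (n : ℕ) : Measurable fun z => dysonTerm T J g n (t, z) :=
    (measurable_dysonTerm hg n).comp measurable_prodMk_left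
  have hD' (n : ℕ) : Measurable fun z =>
      dysonTerm (conj (timeExtend reverse) reverse T) (conj reverse reverse J) f n (t, z) :=
    (measurable_dysonTerm hf n).comp measurable_prodMk_left
  calc ∫⁻ z, f z * ∫⁻ y, g y ∂(transition hU hl t z) ∂(target U)
      = ∑' n, ∫⁻ z, f z * dysonTerm T J g n (t, z) ∂(target U) := by
        simp only [lintegral_transition hU hl ht hg, ← ENNReal.tsum_mul_left]
        exact lintegral_tsum fun n => (hf.mul (hD n)).aemeasurable
    _ = ∑' n, ∫⁻ z, dysonTerm (conj (timeExtend reverse) reverse T) (conj reverse reverse J) f n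
          (t, z) * g z ∂(target U) :=
        tsum_congr fun n => lintegral_mul_dysonTerm (inDuality_flightKernel hU lref)
          (inDuality_jumpKernel hU hl _) hf hg t n
    _ = ∫⁻ z, (∫⁻ y, f y ∂(conj reverse reverse (transition hU hl t) z)) * g z ∂(target U) := by
        rw [← lintegral_tsum fun n => ((hD' n).fun_mul hg).aemeasurable]
        simp only [lintegral_conj, lintegral_transition hU hl ht hf', ENNReal.tsum_mul_right,
          dysonTerm_conj]
        rfl

lemma isProbabilityMeasure_target (hint : Integrable (fun x => Real.exp (-U x)) volume) :
    IsProbabilityMeasure (target U) :=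
  haveI := isProbabilityMeasure_tilted hint
  haveI := isProbabilityMeasure_uniformOn (s := (Set.univ : Set (Vel d))) Set.finite_univ
    Set.univ_nonempty
  inferInstanceAs (IsProbabilityMeasure (Measure.prod _ _))

lemma invariant_transition (hU : ContDiff ℝ 1 U) (hl : 0 < lref) {t : ℝ} (ht : 0 ≤ t) :
    Kernel.Invariant (transition hU hl t) (target U) :=
  haveI := isMarkovKernel_transition hU hl t
  (inDuality_transition hU hl ht).invariant

end TargetDuality

section Generator

lemma integral_fderiv_tilted {E : Type*} [NormedAddCommGroup E] [NormedSpace ℝ E]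
    [FiniteDimensional ℝ E] [MeasurableSpace E] [BorelSpace E] {μ : Measure E}
    [μ.IsAddHaarMeasure] {W g : E → ℝ} (hW : Differentiable ℝ W) (hg : Differentiable ℝ g)
    (hint : Integrable (fun x => Real.exp (W x)) μ) {v : E}
    (hgW : Integrable g (μ.tilted W)) (hg' : Integrable (fun x => fderiv ℝ g x v) (μ.tilted W))
    (hW' : Integrable (fun x => g x * fderiv ℝ W x v) (μ.tilted W)) :
    ∫ x, fderiv ℝ g x v ∂(μ.tilted W) = -∫ x, g x * fderiv ℝ W x v ∂(μ.tilted W) := by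
  rw [integrable_tilted_iff hint] at hgW hg' hW'
  simp only [smul_eq_mul] at hgW hg' hW'
  have hexp (x : E) : g x * fderiv ℝ (fun y => Real.exp (W y)) x v =
      Real.exp (W x) * (g x * fderiv ℝ W x v) := by
    rw [(hW x).hasFDerivAt.exp.fderiv, smul_apply, smul_eq_mul]
    ring
  have hparts := integral_mul_fderiv_eq_neg_fderiv_mul_of_integrable (μ := μ) (f := g)
    (g := fun x => Real.exp (W x)) (v := v) (by simpa only [mul_comm] using hg')
    (by simpa only [hexp] using hW') (by simpa only [mul_comm] using hgW)
    (fun x _ => hg x) (fun x _ => (hW x).exp)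
  simp only [hexp, mul_comm _ (Real.exp _)] at hparts
  simp only [integral_tilted, smul_eq_mul, div_mul_eq_mul_div, integral_div, hparts, neg_div,
    neg_neg]

lemma integrable_slice_of_prod_uniformOn {X V : Type*} [MeasurableSpace X] [MeasurableSpace V]
    [MeasurableSingletonClass V] [Finite V] {μ : Measure X} [SFinite μ] {F : X × V → ℝ}
    (hF : Integrable F (μ.prod (uniformOn Set.univ))) (v : V) :
    Integrable (fun x => F (x, v)) μ := by
  have := Fintype.ofFinite V
  refine ae_iff_of_countable.1 hF.prod_left_ae v ?_
  simp [uniformOn_univ]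

lemma drift_eq_fderiv {f : State d → ℝ} {x : Pos d} {v : Vel d}
    (hf : DifferentiableAt ℝ (fun y => f (y, v)) x) :
    drift f (x, v) = fderiv ℝ (fun y => f (y, v)) x v := by
  rw [hf.hasGradientAt.hasFDerivAt.fderiv, InnerProductSpace.toDual_apply_apply]
  rfl

lemma fderiv_neg_potential (hU : ContDiff ℝ 1 U) (lref : ℝ) (x v : Pos d) :
    fderiv ℝ (fun y => -U y) x v = rate U lref x (-v) - rate U lref x v := by
  rw [← neg_sub, rate_sub_rate_neg, fderiv_fun_neg,
    (hU.differentiable one_ne_zero x).hasGradientAt.hasFDerivAt.fderiv, real_inner_comm]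
  rfl

lemma integrable_of_integrable_rate_mul (hU : ContDiff ℝ 1 U) (hl : 0 < lref)
    {μ : Measure (State d)} {f : State d → ℝ}
    (hf : Integrable (fun z => rate U lref z.1 z.2 * f z) μ) :
    Integrable f μ := by
  have hpos (z : State d) : 0 < rate U lref z.1 z.2 := hl.trans_le (rate_ge _ _ _ _)
  have hinv : Continuous fun z : State d => (rate U lref z.1 z.2)⁻¹ :=
    (continuous_rate_coe hU lref).inv₀ fun z => (hpos z).ne'
  refine (hf.bdd_mul (c := lref⁻¹) hinv.aestronglyMeasurable (ae_of_all _ fun z => ?_)).congr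
    (ae_of_all _ fun z => inv_mul_cancel_left₀ (hpos z).ne' _)
  rw [Real.norm_of_nonneg (inv_nonneg.2 (hpos z).le)]
  exact inv_anti₀ hl (rate_ge _ _ _ _)

lemma integral_drift (hU : ContDiff ℝ 1 U) (hint : Integrable (fun x => Real.exp (-U x)) volume)
    (hl : 0 < lref) {f : State d → ℝ} (hf : Admissible U lref f) :
    ∫ z, drift f z ∂(target U) =
      ∫ z, (rate U lref z.1 z.2 * f z - rate U lref z.1 (-(z.2 : Pos d)) * f z) ∂(target U) := by
  have hdiff : Integrable (fun z : State d => rate U lref z.1 z.2 * f z -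
      rate U lref z.1 (-(z.2 : Pos d)) * f z) (target U) :=
    hf.integrable_rate.sub hf.integrable_rate_neg
  have hf₀ := integrable_of_integrable_rate_mul hU hl hf.integrable_rate
  refine (integral_prod_symm _ hf.integrable_drift).trans
    (Eq.trans ?_ (integral_prod_symm _ hdiff).symm)
  congr 1 with v
  have hdrift (x : Pos d) : drift f (x, v) = fderiv ℝ (fun y => f (y, v)) x v :=
    drift_eq_fderiv (hf.differentiable v x)
  have hrate (x : Pos d) : f (x, v) * fderiv ℝ (fun y => -U y) x v =
      -(rate U lref x v * f (x, v) - rate U lref x (-(v : Pos d)) * f (x, v)) := by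
    rw [fderiv_neg_potential hU lref]
    ring
  have hparts := integral_fderiv_tilted (W := fun x => -U x)
    (hU.differentiable one_ne_zero).fun_neg (hf.differentiable v) hint (v := (v : Pos d))
    (integrable_slice_of_prod_uniformOn hf₀ v)
    (by simpa only [hdrift] using integrable_slice_of_prod_uniformOn hf.integrable_drift v)
    (by simpa only [hrate] using! (integrable_slice_of_prod_uniformOn hdiff v).neg)
  simp only [← hdrift, hrate, integral_neg, neg_neg] at hparts
  exact hparts

lemma conj_reverse_jumpKernel_univ (hU : ContDiff ℝ 1 U) (hl : 0 < lref) (z : State d) :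
    conj reverse reverse (jumpKernel U lref) z Set.univ =
      ENNReal.ofReal (rate U lref z.1 (-(z.2 : Pos d))) := by
  have := isMarkovKernel_velKernel hU hl
  rw [← lintegral_one, lintegral_conj, lintegral_jumpKernel hU lref measurable_const]
  simp

lemma integral_velKernel (hU : ContDiff ℝ 1 U) (hl : 0 < lref) (x : Pos d) (F : Vel d → ℝ) :
    ∫ w, F w ∂(velKernel U lref x) = ∑ w, velProb U lref x w * F w := by
  have hm : Measurable (Function.uncurry fun (x : Pos d) (w : Vel d) =>
      ENNReal.ofReal (velProb U lref x w)) := (measurable_velProb hU lref).ennreal_ofReal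
  have hnonneg (w : Vel d) : 0 ≤ velProb U lref x w :=
    div_nonneg (rate_nonneg hl _ _) (Finset.sum_nonneg fun _ _ => rate_nonneg hl _ _)
  rw [velKernel, Kernel.withDensity_apply _ hm, Kernel.const_apply,
    integral_withDensity_eq_integral_toReal_smul (measurable_of_finite _) (by simp),
    integral_count]
  simp only [ENNReal.toReal_ofReal (hnonneg _), smul_eq_mul]

lemma integral_jumpKernel (hU : ContDiff ℝ 1 U) (hl : 0 < lref) (f : State d → ℝ) (z : State d) :
    ∫ y, f y ∂(jumpKernel U lref z) =
      rate U lref z.1 z.2 * ∑ w, velProb U lref z.1 w * f (z.1, w) := by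
  have hm : Measurable (Function.uncurry fun (z _ : State d) =>
      ENNReal.ofReal (rate U lref z.1 z.2)) :=
    (continuous_rate_coe hU lref).measurable.ennreal_ofReal.comp measurable_fst
  rw [jumpKernel, Kernel.withDensity_apply _ hm, withDensity_const, integral_smul_measure,
    Kernel.prod_apply, Kernel.deterministic_apply, Kernel.comap_apply, Measure.dirac_prod,
    (measurableEmbedding_prodMk_left z.1).integral_map, integral_velKernel hU hl,
    ENNReal.toReal_ofReal (rate_nonneg hl _ _), smul_eq_mul]

lemma generator_eq (hU : ContDiff ℝ 1 U) (hl : 0 < lref) (f : State d → ℝ) :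
    generator U lref f = fun z =>
      drift f z + ∫ y, f y ∂(jumpKernel U lref z) - rate U lref z.1 z.2 * f z := by
  ext z
  have htotal : totalRate U lref z.1 = ∑ w : Vel d, rate U lref z.1 (-(w : Pos d)) :=
    (sum_oppVel fun w : Vel d => rate U lref z.1 w).symm
  simp only [generator, integral_jumpKernel hU hl, velProb, htotal]

lemma generator_invariant (hU : ContDiff ℝ 1 U)
    (hint : Integrable (fun x => Real.exp (-U x)) volume) (hl : 0 < lref) {f : State d → ℝ}
    (hf : Admissible U lref f) :
    Integrable (generator U lref f) (target U) ∧ ∫ z, generator U lref f z ∂(target U) = 0 := by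
  have hdual : InDuality (target U) (jumpKernel U lref)
      (conj reverse reverse (jumpKernel U lref)) := inDuality_jumpKernel hU hl _
  have hfin (z : State d) : conj reverse reverse (jumpKernel U lref) z Set.univ < ∞ := by
    simp [conj_reverse_jumpKernel_univ hU hl]
  have hmass (z : State d) : (conj reverse reverse (jumpKernel U lref) z).real Set.univ =
      rate U lref z.1 (-(z.2 : Pos d)) := by
    rw [measureReal_def, conj_reverse_jumpKernel_univ hU hl,
      ENNReal.toReal_ofReal (rate_nonneg hl _ _)]
  have hneg : Integrable (fun z => (conj reverse reverse (jumpKernel U lref) z).real Set.univ *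
      f z) (target U) := by
    simpa only [hmass] using hf.integrable_rate_neg
  have hgain := hdual.integrable_integral hfin hneg
  have hdrift_gain : Integrable (fun z => drift f z + ∫ y, f y ∂(jumpKernel U lref z)) (target U) :=
    hf.integrable_drift.add hgain
  rw [generator_eq hU hl]
  refine ⟨hdrift_gain.sub hf.integrable_rate, ?_⟩
  rw [integral_sub hdrift_gain hf.integrable_rate, integral_add hf.integrable_drift hgain,
    integral_drift hU hint hl hf, integral_sub hf.integrable_rate hf.integrable_rate_neg,
    hdual.integral_integral hfin hneg]
  simp only [hmass, sub_add_cancel, sub_self]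

end Generator

end IOCS

theorem mainTheorem6 {d : ℕ} (U : IOCS.Pos d → ℝ) (hU : ContDiff ℝ 1 U)
    (hint : Integrable (fun x => Real.exp (-U x)) volume)
    (lref : ℝ) (hl : 0 < lref) :
    (∀ z : IOCS.State d, ∀ᵐ ω ∂(IOCS.skeletonLaw hU hl z),
      StrictMono (fun n => (ω n).1) ∧ Tendsto (fun n => (ω n).1) atTop atTop) ∧
    (IsProbabilityMeasure (IOCS.target U) ∧
      ∀ t : ℝ, 0 ≤ t →
        IsMarkovKernel (IOCS.transition hU hl t) ∧
        Kernel.Invariant (IOCS.transition hU hl t) (IOCS.target U)) ∧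
    (∀ f : IOCS.State d → ℝ, IOCS.Admissible U lref f →
      Integrable (IOCS.generator U lref f) (IOCS.target U) ∧
      ∫ z, IOCS.generator U lref f z ∂(IOCS.target U) = 0) := by
  refine ⟨fun z => ?_, ⟨IOCS.isProbabilityMeasure_target hint, fun t ht =>
    ⟨IOCS.isMarkovKernel_transition hU hl t, IOCS.invariant_transition hU hl ht⟩⟩,
    fun f hf => IOCS.generator_invariant hU hint hl hf⟩
  filter_upwards [IOCS.ae_skeletonLaw_strictMono hU hl z, IOCS.ae_skeletonLaw_tendsto hU hl z]
    with ω hmono htop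
  exact ⟨hmono, htop⟩
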